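/- Let $M$ be a smooth finite-dimensional manifold (Hausdorff, second countable, without boundary, not necessarily compact or connected) with a cooriented contact structure $\xi$, i.e. a field of hyperplanes, each with a chosen positive side, that is the cooriented kernel of a contact form (a smooth nowhere vanishing 1-form $\alpha$ such that $d\alpha$ is nondegenerate on $\ker\alpha$). Its symplectization is $$S\xi=\{p\in T^*M \mid \ker p=\xi \text{ as cooriented hyperplanes}\}\xrightarrow{\ \pi\ } M,$$ with the canonical Liouville form $\lambda_p=p\circ d\pi_p$, the symplectic form $\omega=d\lambda$ and the $\mathbb R$-action $\tau_s(p)=e^sp$. A neighborhood of the positive (respectively negative) end of $S\xi$ is a set containing an open set that meets every fiber of $\pi$ and is invariant under $\tau_s$ for all $s\ge 0$ (respectively all $s\le 0$). A symplectic pseudo-isotopy of $(M,\xi)$ is a diffeomorphism $F$ of $S\xi$ with $F^*\omega=\omega$ that is the identity on a neighborhood of the negative end and satisfies $F^*\lambda=\lambda$ on a neighborhood of the positive end. It induces $\varphi\colon M\to M$ if $\varphi(\pi(p))=\pi(F(p))$ for all $p$ in some neighborhood of the positive end on which $F$ preserves $\lambda$. A contactomorphism of $(M,\xi)$ (a diffeomorphism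 whose differential preserves $\xi$) is symplectically pseudo-isotopic to the identity if it is induced by some symplectic pseudo-isotopy. A compactly supported Hamiltonian isotopy of $S\xi$ is a smooth family $(\Phi_t)_{t\in[0,1]}$ of diffeomorphisms of $S\xi$ with $\Phi_0=\mathrm{id}$ such that $\frac{d}{dt}\Phi_t=X_t\circ\Phi_t$ and $\omega(X_t,\cdot)=dH_t$ for some smooth $H\colon[0,1]\times S\xi\to\mathbb R$, and such that outside some compact subset of $S\xi$ one has $H_t=0$ and $\Phi_t=\mathrm{id}$ for all $t\in[0,1]$. **Lemma 2.4.** Let $\varphi$ be a contactomorphism of $(M,\xi)$ that is symplectically pseudo-isotopic to the identity. For every compact subset $K$ of $S\xi$ there is a compactly supported Hamiltonian isotopy $(\Phi_t)_{t\in[0,1]}$ of $S\xi$ such that $$\pi(\Phi_1(p))=\varphi(\pi(p))\qquad\text{for every } p\in K.$$ -/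

import Mathlib

open Set Bundle
open scoped Manifold ContDiff Topology

noncomputable section

section Forms

variable {E H N : Type*} [NormedAddCommGroup E] [NormedSpace ℝ E] [TopologicalSpace H]
  (I : ModelWithCorners ℝ E H) [TopologicalSpace N] [ChartedSpace H N]

/-- A (not necessarily continuous) field of covectors on the manifold `N`. -/
abbrev CovectorField : Type _ := ∀ x : N, TangentSpace I x →L[ℝ] ℝ

variable {I}

/-- The 1-form `β` written in the chart around `x`: the pullback of `β` by the inverse of
`extChartAt I x`, a 1-form on (an open subset of) the model vector space `E`. -/
def CovectorField.inChart (β : CovectorField (N := N) I) (x : N) (y : E) : E [⋀^Fin 1]→L[ℝ] ℝ :=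
  ContinuousAlternatingMap.ofSubsingleton ℝ E ℝ (0 : Fin 1)
    ((β ((extChartAt I x).symm y)).comp (mfderiv 𝓘(ℝ, E) I (extChartAt I x).symm y))

/-- The exterior derivative `dβ` of a 1-form on a manifold without boundary, computed at `x` in the
chart around `x`. In Mathlib `TangentSpace I x` is by definition `E`, read in this very chart, so
that no further transport is needed. Explicitly
`dβ_x(v, w) = D_v b (w) - D_w b (v)`, where `b` is `β` written in the chart. -/
def CovectorField.d (β : CovectorField (N := N) I) (x : N) (v w : TangentSpace I x) : ℝ :=
  extDeriv (β.inChart x) (extChartAt I x x) ![(v : E), (w : E)]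

end Forms

section Contact

variable (E M : Type*) [NormedAddCommGroup E] [NormedSpace ℝ E]
  [TopologicalSpace M] [ChartedSpace E M] [IsManifold 𝓘(ℝ, E) ∞ M]

/-- The total space of the cotangent bundle `T*M`, with Mathlib's topology. -/
abbrev CotangentSpace : Type _ :=
  TotalSpace (E →L[ℝ] ℝ) (fun x : M => TangentSpace 𝓘(ℝ, E) x →L[ℝ] ℝ)

/-- The model with corners of the symplectization, a manifold of dimension `1 + dim M`. -/
abbrev symplModel : ModelWithCorners ℝ (ℝ × E) (ModelProd ℝ E) := 𝓘(ℝ, ℝ).prod 𝓘(ℝ, E)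

variable {E M}

/-- `α` is a contact form: a smooth nowhere vanishing 1-form such that `dα` is nondegenerate on
each hyperplane `ker α_x`. -/
structure IsContactForm (α : CovectorField (N := M) 𝓘(ℝ, E)) : Prop where
  contMDiff : ContMDiff 𝓘(ℝ, E) (𝓘(ℝ, E).prod 𝓘(ℝ, E →L[ℝ] ℝ)) ∞
    (fun x => (⟨x, α x⟩ : CotangentSpace E M))
  ne_zero : ∀ x, α x ≠ 0
  nondegenerate : ∀ x (v : TangentSpace 𝓘(ℝ, E) x), α x v = 0 →
    (∀ w : TangentSpace 𝓘(ℝ, E) x, α x w = 0 → α.d x v w = 0) → v = 0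

variable (E M) in
/-- A cooriented contact structure: a field of hyperplanes `ξ_x`, each with a positive side, that is
the cooriented kernel of some contact form. -/
structure ContactStructure where
  hyperplane : ∀ x : M, Submodule ℝ (TangentSpace 𝓘(ℝ, E) x)
  positiveSide : ∀ x : M, Set (TangentSpace 𝓘(ℝ, E) x)
  exists_form : ∃ α : CovectorField (N := M) 𝓘(ℝ, E), IsContactForm α ∧
    ∀ x, (α x).ker = hyperplane x ∧ {v | 0 < α x v} = positiveSide x

namespace ContactStructure

variable (ξ : ContactStructure E M)

/-- The symplectization `Sξ = {p ∈ T*M | ker p = ξ}` (equality of cooriented hyperplanes), with the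
topology induced from `T*M`. -/
def Symplectization : Type _ :=
  {p : CotangentSpace E M // p.2.ker = ξ.hyperplane p.1 ∧ {v | 0 < p.2 v} = ξ.positiveSide p.1}

namespace Symplectization

instance : TopologicalSpace ξ.Symplectization := inferInstanceAs (TopologicalSpace (Subtype _))

variable {ξ}

/-- The canonical projection `π : Sξ → M`. -/
def proj (p : ξ.Symplectization) : M := p.1.1

/-- The covector `p` itself, a linear form on the tangent space of `M` at `π(p)`. -/
def covector (p : ξ.Symplectization) : TangentSpace 𝓘(ℝ, E) p.proj →L[ℝ] ℝ := p.1.2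

/-- The `ℝ`-action `τ_s(p) = e^s p`. -/
def translate (s : ℝ) (p : ξ.Symplectization) : ξ.Symplectization :=
  ⟨⟨p.proj, Real.exp s • p.covector⟩, by
    obtain ⟨h1, h2⟩ := p.2
    have hs := Real.exp_pos s
    refine ⟨Eq.trans ?_ h1, Eq.trans ?_ h2⟩
    · ext v
      change Real.exp s • p.1.2 v = 0 ↔ p.1.2 v = 0
      simp
    · ext v
      change 0 < Real.exp s * p.1.2 v ↔ 0 < p.1.2 v
      simp [hs]⟩

end Symplectization

/-- A contact form defining `ξ` (chosen once and for all). -/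
def form : CovectorField (N := M) 𝓘(ℝ, E) := ξ.exists_form.choose

lemma form_isContactForm : IsContactForm ξ.form := ξ.exists_form.choose_spec.1

lemma form_ker (x : M) : (ξ.form x).ker = ξ.hyperplane x := (ξ.exists_form.choose_spec.2 x).1

lemma form_pos (x : M) : {v | 0 < ξ.form x v} = ξ.positiveSide x :=
  (ξ.exists_form.choose_spec.2 x).2

namespace Symplectization

variable {ξ}

lemma exists_eq_smul (p : ξ.Symplectization) : ∃ c : ℝ, 0 < c ∧ p.covector = c • ξ.form p.proj := by
  obtain ⟨h1, h2⟩ := p.2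
  have hα := ξ.form_isContactForm.ne_zero p.proj
  obtain ⟨v, hv⟩ : ∃ v, 0 < ξ.form p.proj v := by
    by_contra! hcon
    apply hα
    ext v
    have a := hcon v
    have b := hcon (-v)
    rw [map_neg] at b
    have : ξ.form p.proj v = 0 := by linarith
    simpa using this
  have hpv : 0 < p.covector v := by
    have : v ∈ ξ.positiveSide p.proj := by rw [← form_pos]; exact hv
    rw [← proj.eq_1 p] at h2
    rw [← h2] at this
    exact this
  refine ⟨p.covector v / ξ.form p.proj v, div_pos hpv hv, ?_⟩
  ext w
  have hw : w - (ξ.form p.proj w / ξ.form p.proj v) • v ∈ (ξ.form p.proj).ker := by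
    rw [LinearMap.mem_ker]
    change ξ.form p.proj (w - (ξ.form p.proj w / ξ.form p.proj v) • v) = 0
    rw [map_sub, map_smul, smul_eq_mul]
    field_simp
    ring
  rw [form_ker] at hw
  have hw2 : p.covector (w - (ξ.form p.proj w / ξ.form p.proj v) • v) = 0 := by
    have : w - (ξ.form p.proj w / ξ.form p.proj v) • v ∈ p.covector.ker := h1 ▸ hw
    exact this
  rw [map_sub, map_smul, smul_eq_mul] at hw2
  change p.covector w = p.covector v / ξ.form p.proj v * ξ.form p.proj w
  field_simp
  field_simp at hw2
  linarith


/-- The positive number `c` such that `p = c α_{π(p)}`, for the chosen contact form `α`. -/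
def ratio (p : ξ.Symplectization) : ℝ := p.exists_eq_smul.choose

lemma ratio_pos (p : ξ.Symplectization) : 0 < p.ratio := p.exists_eq_smul.choose_spec.1

lemma covector_eq (p : ξ.Symplectization) : p.covector = p.ratio • ξ.form p.proj :=
  p.exists_eq_smul.choose_spec.2

lemma ratio_unique (p : ξ.Symplectization) {c : ℝ} (h : p.covector = c • ξ.form p.proj) :
    p.ratio = c :=
  smul_left_injective ℝ (ξ.form_isContactForm.ne_zero p.proj) (p.covector_eq.symm.trans h)

variable (ξ) in
/-- The point `e^t α_x` of `Sξ`. -/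
def ofCoord (q : ℝ × M) : ξ.Symplectization :=
  translate q.1 ⟨⟨q.2, ξ.form q.2⟩, ξ.form_ker q.2, ξ.form_pos q.2⟩

lemma ratio_ofCoord (q : ℝ × M) : (ofCoord ξ q).ratio = Real.exp q.1 :=
  ratio_unique _ rfl

lemma continuous_proj : Continuous (proj : ξ.Symplectization → M) :=
  (FiberBundle.continuous_proj (E →L[ℝ] ℝ) _).comp continuous_subtype_val

lemma continuous_ratio : Continuous (ratio : ξ.Symplectization → ℝ) := by
  rw [continuous_iff_continuousAt]
  intro p₀
  let T := trivializationAt (E →L[ℝ] ℝ) (fun x : M => TangentSpace 𝓘(ℝ, E) x →L[ℝ] ℝ) p₀.proj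
  let a : M → (E →L[ℝ] ℝ) := fun x => (T ⟨x, ξ.form x⟩).2
  have hmem : p₀.proj ∈ T.baseSet := mem_baseSet_trivializationAt _ _ _
  have hT : ∀ (x : M), x ∈ T.baseSet → ∀ (c : ℝ) (η : TangentSpace 𝓘(ℝ, E) x →L[ℝ] ℝ),
      (T ⟨x, c • η⟩).2 = c • (T ⟨x, η⟩).2 := fun x hx c η => (T.linear ℝ hx).map_smul c η
  have ha : ContinuousAt a p₀.proj := by
    have h1 : Continuous (fun x => (⟨x, ξ.form x⟩ : CotangentSpace E M)) :=
      ξ.form_isContactForm.contMDiff.continuous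
    have h2 := T.continuousAt (x := ⟨p₀.proj, ξ.form p₀.proj⟩) (T.mem_source.2 hmem)
    exact (ContinuousAt.comp (f := fun x => (⟨x, ξ.form x⟩ : CotangentSpace E M)) h2
      h1.continuousAt).snd
  have ha0 : a p₀.proj ≠ 0 := by
    intro h0
    apply ξ.form_isContactForm.ne_zero p₀.proj
    have h3 : (T ⟨p₀.proj, ξ.form p₀.proj⟩).2 =
        (T ⟨p₀.proj, (0 : TangentSpace 𝓘(ℝ, E) p₀.proj →L[ℝ] ℝ)⟩).2 := by
      rw [show (T ⟨p₀.proj, ξ.form p₀.proj⟩).2 = 0 from h0]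
      exact ((T.linear ℝ hmem).map_zero).symm
    have h4 := (T.continuousLinearEquivAt ℝ p₀.proj hmem).injective
      (a₁ := ξ.form p₀.proj) (a₂ := 0)
    exact h4 h3
  obtain ⟨v, hv⟩ : ∃ v, a p₀.proj v ≠ 0 := by
    by_contra! h
    exact ha0 (ContinuousLinearMap.ext h)
  have hp : ContinuousAt (fun p : ξ.Symplectization => (T p.1).2) p₀ :=
    (ContinuousAt.comp (f := fun p : ξ.Symplectization => p.1)
      (T.continuousAt (x := p₀.1) (T.mem_source.2 hmem))
      continuous_subtype_val.continuousAt).snd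
  have hq : ContinuousAt (fun p : ξ.Symplectization => (T p.1).2 v / a p.proj v) p₀ := by
    refine ContinuousAt.div (hp.clm_apply continuousAt_const) ?_ hv
    exact (ContinuousAt.comp (f := proj) ha continuous_proj.continuousAt).clm_apply
      continuousAt_const
  refine hq.congr ?_
  have hva : ∀ᶠ x in 𝓝 p₀.proj, a x v ≠ 0 :=
    (ha.clm_apply continuousAt_const).eventually_ne hv
  filter_upwards [continuous_proj.continuousAt.eventually hva,
    continuous_proj.continuousAt.eventually (T.open_baseSet.mem_nhds hmem)] with p h1 h2
  have h3 : (T p.1).2 = p.ratio • a p.proj := by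
    rw [← hT _ h2, ← covector_eq]
    rfl
  rw [h3]
  change p.ratio * a p.proj v / a p.proj v = p.ratio
  field_simp

lemma continuous_ofCoord : Continuous (ofCoord ξ) := by
  refine Continuous.subtype_mk ?_ _
  rw [continuous_iff_continuousAt]
  intro q
  rw [FiberBundle.continuousAt_totalSpace]
  refine ⟨continuous_snd.continuousAt, ?_⟩
  let T := trivializationAt (E →L[ℝ] ℝ) (fun x : M => TangentSpace 𝓘(ℝ, E) x →L[ℝ] ℝ) q.2
  have hmem : q.2 ∈ T.baseSet := mem_baseSet_trivializationAt _ _ _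
  have h1 : Continuous (fun x => (⟨x, ξ.form x⟩ : CotangentSpace E M)) :=
    ξ.form_isContactForm.contMDiff.continuous
  have h2 : ContinuousAt (fun x => (T ⟨x, ξ.form x⟩).2) q.2 :=
    (ContinuousAt.comp (f := fun x => (⟨x, ξ.form x⟩ : CotangentSpace E M))
      (T.continuousAt (x := ⟨q.2, ξ.form q.2⟩) (T.mem_source.2 hmem)) h1.continuousAt).snd
  have h3 : ContinuousAt (fun q : ℝ × M => Real.exp q.1 • (T ⟨q.2, ξ.form q.2⟩).2) q :=
    (Real.continuous_exp.comp continuous_fst).continuousAt.smul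
      (ContinuousAt.comp (f := Prod.snd) h2 continuous_snd.continuousAt)
  refine h3.congr ?_
  filter_upwards [continuous_snd.continuousAt.eventually (T.open_baseSet.mem_nhds hmem)] with r hr
  exact ((T.linear ℝ hr).map_smul (Real.exp r.1) (ξ.form r.2)).symm

variable (ξ) in
/-- The identification of `Sξ` with `ℝ × M` given by the contact form `α`: the point `e^t α_x`
corresponds to `(t, x)`. -/
def coord : ξ.Symplectization ≃ₜ ℝ × M where
  toFun p := (Real.log p.ratio, p.proj)
  invFun := ofCoord ξ
  left_inv p := by
    apply Subtype.ext
    change (⟨p.proj, Real.exp (Real.log p.ratio) • ξ.form p.proj⟩ : CotangentSpace E M) = p.1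
    rw [Real.exp_log p.ratio_pos, ← covector_eq]
    rfl
  right_inv q := by
    change (Real.log (ofCoord ξ q).ratio, q.2) = q
    rw [ratio_ofCoord, Real.log_exp]
  continuous_toFun :=
    (continuous_ratio.log fun p => p.ratio_pos.ne').prodMk continuous_proj
  continuous_invFun := continuous_ofCoord

/-- The smooth structure of `Sξ` for which `(t, x) ↦ e^t α_x` is a diffeomorphism from `ℝ × M`. Any
other contact form defining `ξ` is `e^f α` with `f` smooth, hence gives the same smooth structure,
which is also the one of `Sξ` as a submanifold of `T*M`. -/
instance : ChartedSpace (ModelProd ℝ E) ξ.Symplectization where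
  atlas := {c | ∃ f ∈ atlas (ModelProd ℝ E) (ℝ × M), c = (coord ξ).toOpenPartialHomeomorph.trans f}
  chartAt p := (coord ξ).toOpenPartialHomeomorph.trans (chartAt (ModelProd ℝ E) (coord ξ p))
  mem_chart_source p := by simp
  chart_mem_atlas p := ⟨_, chart_mem_atlas _ _, rfl⟩

instance : IsManifold (symplModel E) ∞ ξ.Symplectization where
  compatible := by
    rintro _ _ ⟨f, hf, rfl⟩ ⟨g, hg, rfl⟩
    have h := (contDiffGroupoid ∞ (symplModel E)).compatible hf hg
    refine StructureGroupoid.mem_of_eqOnSource _ h ⟨?_, ?_⟩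
    · ext y
      simp
    · intro y _
      simp

end Symplectization

/-- The canonical Liouville form `λ` of `Sξ`: `λ_p(v) = p(dπ_p(v))`. -/
def liouville : CovectorField (N := ξ.Symplectization) (symplModel E) := fun p =>
  p.covector.comp (mfderiv (symplModel E) 𝓘(ℝ, E) (Symplectization.proj (ξ := ξ)) p)

/-- The canonical symplectic form `ω = dλ` of `Sξ`. -/
def omega (p : ξ.Symplectization) (v w : TangentSpace (symplModel E) p) : ℝ :=
  ξ.liouville.d p v w

/-- `U` is a neighborhood of the negative end `S_{-∞}ξ`: it contains an open set that is invariant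
under `τ_s` for `s ≤ 0` and meets every fiber of `π`. -/
def IsNhdNegativeEnd (U : Set ξ.Symplectization) : Prop :=
  ∃ V ⊆ U, IsOpen V ∧ (∀ s ≤ (0 : ℝ), ∀ p ∈ V, p.translate s ∈ V) ∧ ∀ x : M, ∃ p ∈ V, p.proj = x

/-- `U` is a neighborhood of the positive end `S_{+∞}ξ`: it contains an open set that is invariant
under `τ_s` for `s ≥ 0` and meets every fiber of `π`. -/
def IsNhdPositiveEnd (U : Set ξ.Symplectization) : Prop :=
  ∃ V ⊆ U, IsOpen V ∧ (∀ s ≥ (0 : ℝ), ∀ p ∈ V, p.translate s ∈ V) ∧ ∀ x : M, ∃ p ∈ V, p.proj = x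

/-- Diffeomorphisms of the symplectization. -/
abbrev SymplDiffeo : Type _ :=
  ξ.Symplectization ≃ₘ^∞⟮symplModel E, symplModel E⟯ ξ.Symplectization

variable {ξ}

/-- `F` is a symplectomorphism of `(Sξ, ω)`: `F^*ω = ω`. -/
def IsSymplectomorphism (F : ξ.SymplDiffeo) : Prop :=
  ∀ (p : ξ.Symplectization) (v w : TangentSpace (symplModel E) p),
    ξ.omega (F p) (mfderiv (symplModel E) (symplModel E) F p v)
      (mfderiv (symplModel E) (symplModel E) F p w) = ξ.omega p v w

/-- `F` preserves the Liouville form on the set `U`: `(F^*λ)_p = λ_p` for every `p ∈ U`. -/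
def PreservesLiouvilleOn (F : ξ.SymplDiffeo) (U : Set ξ.Symplectization) : Prop :=
  ∀ p ∈ U, ∀ v : TangentSpace (symplModel E) p,
    ξ.liouville (F p) (mfderiv (symplModel E) (symplModel E) F p v) = ξ.liouville p v

/-- `F` is a symplectic pseudo-isotopy of `(M, ξ)`: a symplectomorphism of `Sξ` that is the identity
on a neighborhood of the negative end and preserves `λ` on a neighborhood of the positive end. -/
structure IsSymplecticPseudoIsotopy (F : ξ.SymplDiffeo) : Prop where
  symplectic : IsSymplectomorphism F
  eq_id_negative : ∃ U, ξ.IsNhdNegativeEnd U ∧ ∀ p ∈ U, F p = p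
  liouville_positive : ∃ U, ξ.IsNhdPositiveEnd U ∧ PreservesLiouvilleOn F U

/-- The map of `M` induced by `F` at the positive end is `φ`: there is a neighborhood `U` of the
positive end on which `F` preserves `λ` and such that `φ(π(p)) = π(F(p))` for all `p ∈ U`. -/
def Induces (F : ξ.SymplDiffeo) (φ : M → M) : Prop :=
  ∃ U, ξ.IsNhdPositiveEnd U ∧ PreservesLiouvilleOn F U ∧ ∀ p ∈ U, φ p.proj = (F p).proj

variable (ξ) in
/-- `φ` is a contactomorphism of `(M, ξ)`: a diffeomorphism whose differential preserves `ξ`. -/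
def IsContactomorphism (φ : M ≃ₘ^∞⟮𝓘(ℝ, E), 𝓘(ℝ, E)⟯ M) : Prop :=
  ∀ (x : M) (v : TangentSpace 𝓘(ℝ, E) x),
    mfderiv 𝓘(ℝ, E) 𝓘(ℝ, E) φ x v ∈ ξ.hyperplane (φ x) ↔ v ∈ ξ.hyperplane x

variable (ξ) in
/-- `φ` is symplectically pseudo-isotopic to the identity: it is induced by some symplectic
pseudo-isotopy. -/
def IsSymplecticallyPseudoIsotopicToId (φ : M → M) : Prop :=
  ∃ F : ξ.SymplDiffeo, IsSymplecticPseudoIsotopy F ∧ Induces F φ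

/-- `(Φ_t)`, `t ∈ [0, 1]`, is a compactly supported Hamiltonian isotopy of `(Sξ, ω)`: a smooth family
of diffeomorphisms starting at the identity whose velocity is the Hamiltonian vector field `X_t`,
`ω(X_t, ·) = dH_t`, of a smooth time-dependent function `H` on `[0, 1] × Sξ`; both `H_t` and `Φ_t`
are supported in one compact set `C` for all `t`. Values at times outside `[0, 1]` are irrelevant. -/
structure IsCompactlySupportedHamiltonianIsotopy (Φ : ℝ → ξ.SymplDiffeo) : Prop where
  contMDiffOn : ContMDiffOn (𝓘(ℝ, ℝ).prod (symplModel E)) (symplModel E) ∞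
    (fun q : ℝ × ξ.Symplectization => Φ q.1 q.2) (Icc 0 1 ×ˢ univ)
  map_zero : ∀ p, Φ 0 p = p
  exists_hamiltonian : ∃ (H : ℝ → ξ.Symplectization → ℝ) (C : Set ξ.Symplectization),
    ContMDiffOn (𝓘(ℝ, ℝ).prod (symplModel E)) 𝓘(ℝ, ℝ) ∞
      (fun q : ℝ × ξ.Symplectization => H q.1 q.2) (Icc 0 1 ×ˢ univ) ∧
    IsCompact C ∧
    (∀ t ∈ Icc (0 : ℝ) 1, ∀ p ∉ C, H t p = 0 ∧ Φ t p = p) ∧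
    ∀ t ∈ Icc (0 : ℝ) 1, ∀ (p : ξ.Symplectization) (w : TangentSpace (symplModel E) (Φ t p)),
      ξ.omega (Φ t p)
          (mfderivWithin 𝓘(ℝ, ℝ) (symplModel E) (fun s : ℝ => Φ s p) (Icc 0 1) t (1 : ℝ)) w =
        mfderiv (symplModel E) 𝓘(ℝ, ℝ) (H t) (Φ t p) w

end ContactStructure
end Contact
end

/-!
Let `F` be a symplectic pseudo-isotopy inducing `φ`, and let `Ψ_s = τ_{-s} ∘ F ∘ τ_s`. Since `τ_s`
scales `ω` by the constant `e^s`, every `Ψ_s` is a symplectomorphism. For `s → -∞` the compact set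
`K` is first moved into the region where `F` is the identity, so `Ψ_{-S} = id` on `K` for large
`S`; for `s → +∞` it is moved into the region where `F` covers `φ`, so `π ∘ Ψ_S = φ ∘ π` on `K`.
The wanted isotopy is the path `Ψ_s`, `s ∈ [-S, S]`, cut off outside a compact set.

*The path is Hamiltonian.* The form `F^*λ - λ` is closed because `F` is symplectic, and it
vanishes near the negative end. Hence it is exact, `F^*λ - λ = df`, with `f` the integral of the
form along half-orbits of the `ℝ`-action (`exists_primitive`). With the Liouville field `Z`, for
which `ω(Z, ·) = λ`, a computation shows that `Ψ_s` is generated by `-e^{-s} f ∘ F⁻¹ ∘ τ_s`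
(`hasMFDerivAt_conjTranslate`).

*Cutting off.* Multiplying this Hamiltonian by a cutoff function in `s` and one on `Sξ` that is `1`
near the compact set swept out by `K` gives a Hamiltonian of compact support. Its flow exists for all times, is smooth, and
still follows `Ψ_s` on `K` by uniqueness of integral curves (`exists_isotopy_of_compact`).

The smooth dependence of flows on initial values is proved here as well. In a Banach space the
trajectories, rescaled to the time interval `[0, 1]`, are the zeros of a `C^n` map on
`C([0, 1], E)`, to which the implicit function theorem applies (`exists_contDiffOn_local_flow`).
On a manifold the local flows are glued by the group law when they exist for a uniform time
(`exists_contMDiff_global_flow`); time-dependent fields `X_t` on `N` are treated as autonomous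
fields `∂_t + X_t` on `ℝ × N`.

Calculus on `Sξ` is done in the coordinates `(t, x) ↦ e^t α_x` of a contact form `α`, where
`λ = e^t α`, `ω = e^t (dt ∧ α + dα)` and `Z = ∂_t`.
-/

noncomputable section

/-! ### Superposition operators on spaces of continuous functions -/

section Superposition

variable {X : Type*} [TopologicalSpace X] [CompactSpace X]

set_option synthInstance.maxHeartbeats 400000 in
/-- The pairing `(A, h) ↦ (x ↦ A x (h x))` as a continuous bilinear map on spaces of continuous
functions with the supremum norm. -/
def ContinuousMap.pointwiseApplyL (X : Type*) [TopologicalSpace X] [CompactSpace X]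
    (E F : Type*) [NormedAddCommGroup E] [NormedSpace ℝ E]
    [NormedAddCommGroup F] [NormedSpace ℝ F] : C(X, E →L[ℝ] F) →L[ℝ] C(X, E) →L[ℝ] C(X, F) :=
  LinearMap.mkContinuous₂
    (LinearMap.mk₂ ℝ (fun (A : C(X, E →L[ℝ] F)) (h : C(X, E)) =>
        (⟨fun x => A x (h x), A.continuous.clm_apply h.continuous⟩ : C(X, F)))
      (fun A B h => by ext x; simp) (fun c A h => by ext x; simp)
      (fun A h k => by ext x; simp) (fun c A h => by ext x; simp)) 1
    (fun A h => by
      rw [ContinuousMap.norm_le _ (by positivity)]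
      intro x
      rw [one_mul]
      exact (A x).le_of_opNorm_le_of_le (A.norm_coe_le_norm x) (h.norm_coe_le_norm x))

/-- Uniform continuity of `g` along the compact image of `γ`, for perturbations of `γ`. -/
lemma ContinuousMap.exists_forall_dist_comp_le {Y Z : Type*} [PseudoMetricSpace Y]
    [PseudoMetricSpace Z] {g : Y → Z} (hg : Continuous g) (γ : C(X, Y)) {ε : ℝ} (hε : 0 < ε) :
    ∃ δ > 0, ∀ γ' : C(X, Y), dist γ' γ < δ → ∀ x, dist (g (γ' x)) (g (γ x)) ≤ ε := by
  have hc : Continuous (fun γ : C(X, Y) => (⟨g, hg⟩ : C(Y, Z)).comp γ) :=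
    ContinuousMap.continuous_postcomp _
  obtain ⟨δ, hδ, hδ'⟩ := Metric.continuous_iff.1 hc γ ε hε
  exact ⟨δ, hδ, fun γ' h x => (ContinuousMap.dist_apply_le_dist x).trans (hδ' γ' h).le⟩

set_option synthInstance.maxHeartbeats 400000 in
/-- The derivative of `γ ↦ f ∘ γ` at `γ` is `h ↦ (x ↦ f' (γ x) (h x))`. -/
lemma ContinuousMap.hasFDerivAt_comp_left {E F : Type*} [NormedAddCommGroup E] [NormedSpace ℝ E]
    [NormedAddCommGroup F] [NormedSpace ℝ F] {f : E → F} (hf : Continuous f)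
    {f' : E → E →L[ℝ] F} (hf' : Continuous f') (h : ∀ y, HasFDerivAt f (f' y) y) (γ : C(X, E)) :
    HasFDerivAt (fun γ : C(X, E) => (⟨f, hf⟩ : C(E, F)).comp γ)
      (ContinuousMap.pointwiseApplyL X E F ((⟨f', hf'⟩ : C(E, E →L[ℝ] F)).comp γ)) γ := by
  rw [hasFDerivAt_iff_isLittleO_nhds_zero, Asymptotics.isLittleO_iff]
  intro ε hε
  obtain ⟨δ, hδ, hδ'⟩ := ContinuousMap.exists_forall_dist_comp_le hf' γ hε
  rw [Metric.eventually_nhds_iff]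
  refine ⟨δ, hδ, fun k hk => ?_⟩
  rw [dist_zero_right] at hk
  rw [ContinuousMap.norm_le _ (by positivity)]
  intro x
  have hx : ‖k x‖ < δ := (k.norm_coe_le_norm x).trans_lt hk
  -- Testing the choice of `δ` on translates of `γ` by constants bounds `f'` on the whole ball.
  have key : ∀ y ∈ Metric.ball (γ x) δ, ‖f' y - f' (γ x)‖ ≤ ε := by
    intro y hy
    have h1 := hδ' (γ + ContinuousMap.const X (y - γ x)) (by
      rw [dist_eq_norm, add_sub_cancel_left]
      refine lt_of_le_of_lt ((ContinuousMap.norm_le _ (norm_nonneg (y - γ x))).2 fun _ => le_rfl) ?_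
      rwa [← dist_eq_norm]) x
    simpa [dist_eq_norm] using h1
  have := (convex_ball (γ x) δ).norm_image_sub_le_of_norm_hasFDerivWithin_le'
    (fun y _ => (h y).hasFDerivWithinAt) key (Metric.mem_ball_self hδ)
    (show γ x + k x ∈ Metric.ball (γ x) δ by simpa [dist_eq_norm] using hx)
  rw [add_sub_cancel_left] at this
  exact this.trans (mul_le_mul_of_nonneg_left (k.norm_coe_le_norm x) hε.le)

universe u in
set_option synthInstance.maxHeartbeats 400000 in
/-- Composition with a `C^n` map is a `C^n` map between spaces of continuous functions on a compact
space: its derivative is again an operator of this kind, followed by a bounded linear map. The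
induction replaces `F` by `E →L[ℝ] F`, which is why both spaces live in one universe. -/
lemma ContinuousMap.contDiff_comp_left {E F : Type u} [NormedAddCommGroup E] [NormedSpace ℝ E]
    [NormedAddCommGroup F] [NormedSpace ℝ F] {n : ℕ} {f : E → F} (hf : ContDiff ℝ n f)
    (hc : Continuous f) : ContDiff ℝ n (fun γ : C(X, E) => (⟨f, hc⟩ : C(E, F)).comp γ) := by
  induction n generalizing F with
  | zero =>
    rw [Nat.cast_zero, contDiff_zero]
    exact ContinuousMap.continuous_postcomp _
  | succ n ih =>
    rw [Nat.cast_add, Nat.cast_one] at hf ⊢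
    obtain ⟨f', hf', h⟩ := contDiff_succ_iff_hasFDerivAt.1 hf
    refine contDiff_succ_iff_hasFDerivAt.2 ⟨fun γ => ContinuousMap.pointwiseApplyL X E F
      ((⟨f', hf'.continuous⟩ : C(E, E →L[ℝ] F)).comp γ), ?_, fun γ => ?_⟩
    · exact (ContinuousMap.pointwiseApplyL X E F).contDiff.comp (ih hf' hf'.continuous)
    · exact ContinuousMap.hasFDerivAt_comp_left hc hf'.continuous h γ

end Superposition

/-! ### Local flows in Banach spaces -/

section LocalFlow

variable {E : Type*} [NormedAddCommGroup E] [NormedSpace ℝ E]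

/-- The operator `γ ↦ (s ↦ ∫₀ˢ γ)` on `C([0, 1], E)`. -/
def ContinuousMap.primitiveL (E : Type*) [NormedAddCommGroup E] [NormedSpace ℝ E] :
    C(unitInterval, E) →L[ℝ] C(unitInterval, E) :=
  LinearMap.mkContinuous
    { toFun := fun γ => ⟨fun s => ∫ r in (0 : ℝ)..s, Set.IccExtend zero_le_one γ r, by
          have hc : Continuous (Set.IccExtend zero_le_one γ) := γ.continuous.Icc_extend'
          exact (intervalIntegral.continuous_primitive
            (fun a b => hc.intervalIntegrable a b) 0).comp continuous_subtype_val⟩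
      map_add' := fun γ δ => by
        ext s
        have h1 : Continuous (Set.IccExtend zero_le_one γ) := γ.continuous.Icc_extend'
        have h2 : Continuous (Set.IccExtend zero_le_one δ) := δ.continuous.Icc_extend'
        exact intervalIntegral.integral_add (h1.intervalIntegrable _ _) (h2.intervalIntegrable _ _)
      map_smul' := fun c γ => by
        ext s
        exact intervalIntegral.integral_smul c _ } 1
    (fun γ => by
      rw [ContinuousMap.norm_le _ (by positivity)]
      intro s
      have h := intervalIntegral.norm_integral_le_of_norm_le_const (a := 0) (b := (s : ℝ))
        (f := Set.IccExtend zero_le_one γ) (C := ‖γ‖) (fun r _ => γ.norm_coe_le_norm _)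
      refine h.trans ?_
      rw [sub_zero, abs_of_nonneg s.2.1, one_mul]
      exact mul_le_of_le_one_right (norm_nonneg _) s.2.2)

lemma ContinuousMap.primitiveL_apply (γ : C(unitInterval, E)) (s : unitInterval) :
    ContinuousMap.primitiveL E γ s = ∫ r in (0 : ℝ)..s, Set.IccExtend zero_le_one γ r := rfl

/-- The operator sending a vector to the constant function. -/
def ContinuousMap.constantL (E : Type*) [NormedAddCommGroup E] [NormedSpace ℝ E] :
    E →L[ℝ] C(unitInterval, E) :=
  LinearMap.mkContinuous
    { toFun := ContinuousMap.const unitInterval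
      map_add' := fun _ _ => rfl
      map_smul' := fun _ _ => rfl } 1
    (fun x => by
      rw [ContinuousMap.norm_le _ (by positivity), one_mul]
      exact fun _ => le_rfl)

variable [CompleteSpace E]

/-- The local flow of a `C^n` vector field is `C^n` in time and initial point together. After
rescaling time to `[0, 1]`, the trajectory `γ` starting from `x` and running for time `τ` is the
solution of `γ = x + τ ∫ f ∘ γ` in `C([0, 1], E)`, an equation depending smoothly on the parameters
`(τ, x)` whose linearization in `γ` is the identity at `τ = 0`. -/
theorem exists_contDiffOn_local_flow {n : ℕ} (hn : 1 ≤ n) {f : E → E} (hf : ContDiff ℝ n f)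
    (x₀ : E) :
    ∃ ε > 0, ∃ U ∈ 𝓝 x₀, ∃ α : ℝ × E → E, ContDiffOn ℝ n α (Ioo (-ε) ε ×ˢ U) ∧
      ∀ x ∈ U, α (0, x) = x ∧
        ∀ t ∈ Ioo (-ε) ε, HasDerivAt (fun t => α (t, x)) (f (α (t, x))) t := by
  have hf1 : ContDiffAt ℝ 1 f x₀ := (hf.of_le (by exact_mod_cast hn)).contDiffAt
  obtain ⟨ε, hε, a, r, L, K, hr, hPL⟩ := IsPicardLindelof.of_contDiffAt_one hf1
  obtain ⟨β, hβ, hβc⟩ :=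
    (hPL 0).exists_forall_mem_closedBall_eq_hasDerivWithinAt_continuousOn
  simp only [zero_sub, zero_add] at hβ hβc
  have hn0 : (n : WithTop ℕ∞) ≠ 0 := by
    simp only [ne_eq, Nat.cast_eq_zero]
    omega
  have hβd : ∀ x ∈ Metric.closedBall x₀ (r : ℝ), ∀ t ∈ Ioo (-ε) ε,
      HasDerivAt (fun t => β (x, t)) (f (β (x, t))) t := fun x hx t ht =>
    ((hβ x hx).2 t (Ioo_subset_Icc_self ht)).hasDerivAt (Icc_mem_nhds ht.1 ht.2)
  -- The zeros `((τ, x), γ)` of `G` are the trajectories from `x` for time `τ`, with time rescaled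
  -- to `[0, 1]`.
  let G : (ℝ × E) × C(unitInterval, E) → C(unitInterval, E) := fun v =>
    v.2 - ContinuousMap.constantL E v.1.2 -
      v.1.1 • ContinuousMap.primitiveL E ((⟨f, hf.continuous⟩ : C(E, E)).comp v.2)
  have hG : ContDiff ℝ n G := by
    refine (contDiff_snd.sub ((ContinuousMap.constantL E).contDiff.comp
      (contDiff_snd.comp contDiff_fst))).sub ((contDiff_fst.comp contDiff_fst).smul ?_)
    exact (ContinuousMap.primitiveL E).contDiff.comp
      ((ContinuousMap.contDiff_comp_left hf hf.continuous).comp contDiff_snd)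
  let u : (ℝ × E) × C(unitInterval, E) := ((0, x₀), ContinuousMap.constantL E x₀)
  have hGu : G u = 0 := by simp [G, u]
  have hinv : (fderiv ℝ G u ∘L .inr ℝ (ℝ × E) C(unitInterval, E)).IsInvertible := by
    have h1 : HasFDerivAt (fun γ : C(unitInterval, E) => G ((0, x₀), γ))
        (fderiv ℝ G u ∘L .inr ℝ (ℝ × E) C(unitInterval, E)) (ContinuousMap.constantL E x₀) :=
      HasFDerivAt.comp (f := fun γ : C(unitInterval, E) => (((0 : ℝ), x₀), γ))
        (ContinuousMap.constantL E x₀) (hG.differentiable hn0 u).hasFDerivAt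
        (hasFDerivAt_prodMk_right _ _)
    have h2 : HasFDerivAt (fun γ : C(unitInterval, E) => G ((0, x₀), γ))
        (ContinuousLinearMap.id ℝ _) (ContinuousMap.constantL E x₀) := by
      have : (fun γ : C(unitInterval, E) => G ((0, x₀), γ)) =
          fun γ => γ - ContinuousMap.constantL E x₀ := by
        funext γ
        simp [G]
      rw [this]
      exact (hasFDerivAt_id _).sub_const _
    rw [h1.unique h2]
    exact ContinuousLinearMap.IsInvertible.of_inverse (g := ContinuousLinearMap.id ℝ _) rfl rfl
  have hψ := (hG.contDiffAt (x := u)).contDiffAt_implicitFunction hn0 hinv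
  have hiff := (hG.contDiffAt (x := u)).eventually_apply_eq_iff_implicitFunction hn0 hinv
  set ψ := (hG.contDiffAt (x := u)).implicitFunction hn0 hinv with hψdef
  -- The trajectory given by the Picard-Lindelöf theorem, with a junk value outside its domain.
  classical
  let c : ℝ × E → C(unitInterval, E) := fun p =>
    if h : Continuous (fun s : unitInterval => β (p.2, s * p.1)) then ⟨_, h⟩ else
      ContinuousMap.constantL E x₀
  have hmem : ∀ s : unitInterval, ∀ τ ∈ Ioo (-ε) ε, (s * τ : ℝ) ∈ Ioo (-ε) ε := by
    intro s τ hτ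
    rw [mem_Ioo, ← abs_lt] at hτ ⊢
    rw [abs_mul, abs_of_nonneg s.2.1]
    exact (mul_le_of_le_one_left (abs_nonneg _) s.2.2).trans_lt hτ
  have hcapp : ∀ τ ∈ Ioo (-ε) ε, ∀ x ∈ Metric.closedBall x₀ (r : ℝ), ∀ s : unitInterval,
      c (τ, x) s = β (x, s * τ) := by
    intro τ hτ x hx s
    have h : Continuous (fun s : unitInterval => β (x, s * τ)) :=
      hβc.comp_continuous (by fun_prop) fun s => ⟨hx, Ioo_subset_Icc_self (hmem s τ hτ)⟩
    simp only [c, dif_pos h]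
    rfl
  have hdom : ∀ᶠ p : ℝ × E in 𝓝 (0, x₀), p.1 ∈ Ioo (-ε) ε ∧ p.2 ∈ Metric.closedBall x₀ (r : ℝ) :=
    prod_mem_nhds (Ioo_mem_nhds (by linarith) hε) (Metric.closedBall_mem_nhds x₀ hr)
  -- Near `(0, x₀)` the trajectories are uniformly close to the constant curve `x₀`, so that the
  -- uniqueness part of the implicit function theorem applies to them.
  have hlim : Filter.Tendsto (fun p => (p, c p)) (𝓝 ((0 : ℝ), x₀)) (𝓝 u) := by
    refine Filter.Tendsto.prodMk_nhds Filter.tendsto_id ?_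
    rw [Metric.tendsto_nhds]
    intro η hη
    have hca : ContinuousAt β (x₀, 0) := hβc.continuousAt
      (prod_mem_nhds (Metric.closedBall_mem_nhds x₀ hr) (Icc_mem_nhds (by linarith) hε))
    have h0 : β (x₀, 0) = x₀ := (hβ x₀ (Metric.mem_closedBall_self hr.le)).1
    obtain ⟨δ, hδ, hδ'⟩ := Metric.continuousAt_iff.1 hca (η / 2) (by positivity)
    have hball : ∀ᶠ p : ℝ × E in 𝓝 (0, x₀), p ∈ Metric.ball ((0 : ℝ), x₀) δ :=
      Metric.ball_mem_nhds _ hδ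
    filter_upwards [hdom, hball] with p hp hpb
    refine lt_of_le_of_lt ?_ (half_lt_self hη)
    rw [ContinuousMap.dist_le (by positivity)]
    intro s
    rw [show c p s = c (p.1, p.2) s from rfl, hcapp p.1 hp.1 p.2 hp.2 s]
    rw [h0] at hδ'
    refine (hδ' ?_).le
    rw [Metric.mem_ball, Prod.dist_eq, max_lt_iff] at hpb
    rw [Prod.dist_eq, max_lt_iff]
    refine ⟨hpb.2, lt_of_le_of_lt ?_ hpb.1⟩
    simp only [dist_zero_right, Real.norm_eq_abs, abs_mul]
    rw [abs_of_nonneg s.2.1]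
    exact mul_le_of_le_one_left (abs_nonneg _) s.2.2
  have hGc : ∀ τ ∈ Ioo (-ε) ε, ∀ x ∈ Metric.closedBall x₀ (r : ℝ), G ((τ, x), c (τ, x)) = 0 := by
    intro τ hτ x hx
    ext s
    change c (τ, x) s - x - τ • ContinuousMap.primitiveL E
      ((⟨f, hf.continuous⟩ : C(E, E)).comp (c (τ, x))) s = 0
    rw [ContinuousMap.primitiveL_apply, hcapp τ hτ x hx, ← intervalIntegral.integral_smul]
    have hI : ∀ r ∈ uIcc (0 : ℝ) s, r ∈ Icc (0 : ℝ) 1 := by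
      intro r hr
      rw [uIcc_of_le s.2.1] at hr
      exact ⟨hr.1, hr.2.trans s.2.2⟩
    have hint : ∫ r in (0 : ℝ)..s, τ • Set.IccExtend zero_le_one
        ((⟨f, hf.continuous⟩ : C(E, E)).comp (c (τ, x))) r =
        ∫ r in (0 : ℝ)..s, τ • f (β (x, r * τ)) := by
      refine intervalIntegral.integral_congr fun r hr => ?_
      simp only [Set.IccExtend_of_mem _ _ (hI r hr)]
      change τ • f (c (τ, x) ⟨r, hI r hr⟩) = _
      rw [hcapp τ hτ x hx]
    have hcont : ContinuousOn (fun r : ℝ => τ • f (β (x, r * τ))) (uIcc (0 : ℝ) s) := by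
      refine (hf.continuous.comp_continuousOn (hβc.comp (by fun_prop) ?_)).const_smul τ
      intro r hr
      exact ⟨hx, Ioo_subset_Icc_self (hmem ⟨r, hI r hr⟩ τ hτ)⟩
    rw [hint, intervalIntegral.integral_eq_sub_of_hasDerivAt
      (f := fun r : ℝ => β (x, r * τ)) (f' := fun r => τ • f (β (x, r * τ))) ?_
      hcont.intervalIntegrable]
    · simp [(hβ x hx).1]
    · intro r hr
      have h1 := hβd x hx (r * τ) (hmem ⟨r, hI r hr⟩ τ hτ)
      have h2 : HasDerivAt (fun r : ℝ => r * τ) τ r := by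
        simpa using (hasDerivAt_id r).mul_const τ
      exact h1.scomp r h2
  have hev : ∀ᶠ p : ℝ × E in 𝓝 (0, x₀), ContDiffAt ℝ n ψ p ∧ ψ p = c p := by
    have h1 : ∀ᶠ p : ℝ × E in 𝓝 (0, x₀), ContDiffAt ℝ n ψ p :=
      ContDiffAt.eventually (x := (0, x₀)) hψ (by simp)
    filter_upwards [h1, hlim.eventually hiff, hdom] with p h1 h2 h3
    exact ⟨h1, h2.1 ((hGc p.1 h3.1 p.2 h3.2).trans hGu.symm)⟩
  rw [Filter.Eventually, mem_nhds_prod_iff'] at hev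
  obtain ⟨A, U, hA, h0A, hU, hxU, hAU⟩ := hev
  obtain ⟨δ, hδ, hδA⟩ := Metric.isOpen_iff.1 hA 0 h0A
  have hIoo : ∀ t ∈ Ioo (-min δ ε) (min δ ε), t ∈ A ∧ t ∈ Ioo (-ε) ε := by
    intro t ht
    rw [mem_Ioo, ← abs_lt, lt_min_iff] at ht
    exact ⟨hδA (by simpa using ht.1), abs_lt.1 ht.2⟩
  refine ⟨min δ ε, lt_min hδ hε, U ∩ Metric.closedBall x₀ r,
    Filter.inter_mem (hU.mem_nhds hxU) (Metric.closedBall_mem_nhds x₀ hr),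
    fun p => β (p.2, p.1), ?_, fun x hx => ⟨(hβ x hx.2).1, fun t ht => hβd x hx.2 t (hIoo t ht).2⟩⟩
  -- The flow is the evaluation of the rescaled trajectory at time `1`.
  have h1 : ContDiffOn ℝ n (fun p => ψ p 1)
      (Ioo (-min δ ε) (min δ ε) ×ˢ (U ∩ Metric.closedBall x₀ r)) := by
    intro p hp
    have := (hAU (show p ∈ A ×ˢ U from ⟨(hIoo _ hp.1).1, hp.2.1⟩)).1
    exact ((ContinuousMap.evalCLM ℝ (1 : unitInterval)).contDiff.contDiffAt.comp p
      this).contDiffWithinAt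
  refine h1.congr fun p hp => ?_
  have h2 := (hAU (show p ∈ A ×ˢ U from ⟨(hIoo _ hp.1).1, hp.2.1⟩)).2
  rw [h2, show c p 1 = c (p.1, p.2) 1 from rfl, hcapp p.1 (hIoo _ hp.1).2 p.2 hp.2.2]
  simp

end LocalFlow

/-! ### Vector fields in charts -/

section Charts

variable {E H N : Type*} [NormedAddCommGroup E] [NormedSpace ℝ E] [TopologicalSpace H]
  {I : ModelWithCorners ℝ E H} [I.Boundaryless] [TopologicalSpace N] [ChartedSpace H N]
  [IsManifold I ∞ N]

lemma mdifferentiableAt_extChartAt_symm (x : N) {y : E} (hy : y ∈ (extChartAt I x).target) :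
    MDifferentiableAt 𝓘(ℝ, E) I (extChartAt I x).symm y :=
  (mdifferentiableWithinAt_extChartAt_symm hy).mdifferentiableAt
    (by rw [I.range_eq_univ]; exact Filter.univ_mem)

lemma mfderiv_extChartAt_symm_apply_mfderiv (x : N) {y : E} (hy : y ∈ (extChartAt I x).target)
    (v : TangentSpace I ((extChartAt I x).symm y)) :
    mfderiv 𝓘(ℝ, E) I (extChartAt I x).symm y
      (mfderiv I 𝓘(ℝ, E) (extChartAt I x) ((extChartAt I x).symm y) v) = v := by
  have h := mfderivWithin_extChartAt_symm_comp_mfderiv_extChartAt hy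
  rw [I.range_eq_univ, mfderivWithin_univ] at h
  exact congrArg (fun L => L v) h

lemma mfderiv_extChartAt_apply_mfderiv_symm (x : N) {y : E} (hy : y ∈ (extChartAt I x).target)
    (v : TangentSpace 𝓘(ℝ, E) y) :
    mfderiv I 𝓘(ℝ, E) (extChartAt I x) ((extChartAt I x).symm y)
      (mfderiv 𝓘(ℝ, E) I (extChartAt I x).symm y v) = v := by
  have h := mfderiv_extChartAt_comp_mfderivWithin_extChartAt_symm hy
  rw [I.range_eq_univ, mfderivWithin_univ] at h
  exact congrArg (fun L => L v) h

/-- The vector field `V` read in the chart around `x`. -/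
def vectorFieldInChart (V : ∀ p : N, TangentSpace I p) (x : N) (y : E) : E :=
  mfderiv I 𝓘(ℝ, E) (extChartAt I x) ((extChartAt I x).symm y) (V ((extChartAt I x).symm y))

/-- A vector field is smooth if and only if it is smooth in all charts. -/
lemma contMDiff_vectorField_iff {V : ∀ p : N, TangentSpace I p} :
    ContMDiff I I.tangent ∞ (fun p => (⟨p, V p⟩ : TangentBundle I N)) ↔
      ∀ x, ContDiffOn ℝ ∞ (vectorFieldInChart V x) (extChartAt I x).target := by
  have key : ∀ x p : N, p ∈ (chartAt H x).source →
      ((trivializationAt E (TangentSpace I) x) ⟨p, V p⟩).2 =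
        vectorFieldInChart V x (extChartAt I x p) := by
    intro x p hp
    have h1 := TangentBundle.continuousLinearMapAt_trivializationAt (I := I) hp
    have h2 : ((trivializationAt E (TangentSpace I) x) ⟨p, V p⟩).2 =
        Trivialization.continuousLinearMapAt ℝ (trivializationAt E (TangentSpace I) x) p (V p) := by
      rw [Trivialization.continuousLinearMapAt_apply, Trivialization.coe_linearMapAt_of_mem]
      exact hp
    rw [h2, h1, vectorFieldInChart, (extChartAt I x).left_inv (by rwa [extChartAt_source])]
    rfl
  constructor
  · intro hV x
    rw [← contMDiffOn_iff_contDiffOn]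
    intro y hy
    set p := (extChartAt I x).symm y with hp
    have hps : p ∈ (chartAt H x).source := by
      rw [← extChartAt_source I]; exact (extChartAt I x).map_target hy
    have h1 : ContMDiffAt I 𝓘(ℝ, E) ∞
        (fun q => ((trivializationAt E (TangentSpace I) x) ⟨q, V q⟩).2) p :=
      (Trivialization.contMDiffAt_section_iff (trivializationAt E (TangentSpace I) x) hps).1 (hV p)
    have h2 := ContMDiffWithinAt.comp y
      (g := fun q => ((trivializationAt E (TangentSpace I) x) ⟨q, V q⟩).2)
      h1.contMDiffWithinAt (contMDiffOn_extChartAt_symm (I := I) (n := ∞) x y hy) (mapsTo_univ _ _)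
    refine h2.congr (fun z hz => ?_) ?_
    · have hz' := key x ((extChartAt I x).symm z)
        (by rw [← extChartAt_source I]; exact (extChartAt I x).map_target hz)
      rw [(extChartAt I x).right_inv hz] at hz'
      exact hz'.symm
    · have hz' := key x ((extChartAt I x).symm y) hps
      rw [(extChartAt I x).right_inv hy] at hz'
      exact hz'.symm
  · intro hV x
    refine (Bundle.contMDiffAt_section x).2 ?_
    have h1 : ContMDiffAt I 𝓘(ℝ, E) ∞ (fun p => vectorFieldInChart V x (extChartAt I x p)) x := by
      have h2 : ContMDiffAt 𝓘(ℝ, E) 𝓘(ℝ, E) ∞ (vectorFieldInChart V x) (extChartAt I x x) :=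
        ((hV x).contDiffAt
          ((isOpen_extChartAt_target x).mem_nhds (mem_extChartAt_target x))).contMDiffAt
      exact h2.comp x contMDiffAt_extChartAt
    refine h1.congr_of_eventuallyEq ?_
    filter_upwards [(chartAt H x).open_source.mem_nhds (mem_chart_source H x)] with p hp
    exact key x p hp

lemma hasMFDerivAt_of_hasDerivAt_extChartAt {V : ∀ p : N, TangentSpace I p} (x : N) {c : ℝ → E}
    {t : ℝ} (hc : c t ∈ (extChartAt I x).target)
    (h : HasDerivAt c (vectorFieldInChart V x (c t)) t) :
    HasMFDerivAt 𝓘(ℝ, ℝ) I (fun s => (extChartAt I x).symm (c s)) t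
      ((1 : ℝ →L[ℝ] ℝ).smulRight (V ((extChartAt I x).symm (c t)))) := by
  have h1 := (mdifferentiableAt_extChartAt_symm (I := I) x hc).hasMFDerivAt.comp t
    h.hasFDerivAt.hasMFDerivAt
  refine h1.congr_mfderiv ?_
  refine ContinuousLinearMap.ext_ring ?_
  change mfderiv 𝓘(ℝ, E) I (extChartAt I x).symm (c t) ((1 : ℝ) • vectorFieldInChart V x (c t)) =
    (1 : ℝ) • V ((extChartAt I x).symm (c t))
  rw [one_smul, one_smul]
  exact mfderiv_extChartAt_symm_apply_mfderiv x hc _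

end Charts

/-! ### Local flows on manifolds -/

section LocalFlow

variable {E H N : Type*} [NormedAddCommGroup E] [NormedSpace ℝ E] [FiniteDimensional ℝ E]
  [TopologicalSpace H]
  {I : ModelWithCorners ℝ E H} [I.Boundaryless] [TopologicalSpace N] [ChartedSpace H N]
  [IsManifold I ∞ N]

/-- A function that is smooth near a point agrees near that point with a globally smooth one. -/
lemma exists_contDiff_eventuallyEq {F : Type*} [NormedAddCommGroup F] [NormedSpace ℝ F]
    {f : E → F} {s : Set E} (hs : IsOpen s) (hf : ContDiffOn ℝ ∞ f s) {x : E} (hx : x ∈ s) :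
    ∃ g : E → F, ContDiff ℝ ∞ g ∧ g =ᶠ[𝓝 x] f := by
  obtain ⟨δ, hδ, hδs⟩ := Metric.isOpen_iff.1 hs x hx
  let b : ContDiffBump x := ⟨δ / 4, δ / 2, by positivity, by linarith⟩
  refine ⟨fun y => b y • f y, contDiff_iff_contDiffAt.2 fun y => ?_, ?_⟩
  · by_cases hy : y ∈ Metric.closedBall x (δ / 2)
    · have hys : y ∈ s := hδs (Metric.closedBall_subset_ball (by linarith) hy)
      exact b.contDiff.contDiffAt.smul (hf.contDiffAt (hs.mem_nhds hys))
    · refine (contDiffAt_const (c := (0 : F))).congr_of_eventuallyEq ?_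
      filter_upwards [Metric.isClosed_closedBall.isOpen_compl.mem_nhds hy] with z hz
      have : b z = 0 := b.zero_of_le_dist (by
        rw [mem_compl_iff, Metric.mem_closedBall, not_le] at hz
        exact hz.le)
      rw [this, zero_smul]
  · filter_upwards [b.eventuallyEq_one] with y hy
    rw [hy]
    simp

/-- Local flows of smooth vector fields on a manifold are of class `C^n` for each finite `n`, on a
neighborhood that may depend on `n`. -/
lemma exists_contMDiffOn_local_flow {V : ∀ p : N, TangentSpace I p}
    (hV : ContMDiff I I.tangent ∞ (fun p => (⟨p, V p⟩ : TangentBundle I N)))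
    {n : ℕ} (hn : 1 ≤ n) (p₀ : N) :
    ∃ ε > 0, ∃ U ∈ 𝓝 p₀, ∃ θ : ℝ × N → N,
      ContMDiffOn (𝓘(ℝ, ℝ).prod I) I n θ (Ioo (-ε) ε ×ˢ U) ∧
      ∀ p ∈ U, θ (0, p) = p ∧ IsMIntegralCurveOn (fun t => θ (t, p)) V (Ioo (-ε) ε) := by
  set φ := extChartAt I p₀ with hφ
  have hopen : IsOpen φ.target := isOpen_extChartAt_target p₀
  have hx₀ : φ p₀ ∈ φ.target := mem_extChartAt_target p₀
  obtain ⟨f, hf, hfV⟩ := exists_contDiff_eventuallyEq hopen (contMDiff_vectorField_iff.1 hV p₀) hx₀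
  obtain ⟨ε, hε, U, hU, α, hα, hαd⟩ :=
    exists_contDiffOn_local_flow hn (hf.of_le (by exact_mod_cast le_top)) (φ p₀)
  obtain ⟨W, hW, hWo, hxW⟩ := mem_nhds_iff.1 (Filter.inter_mem hfV (hopen.mem_nhds hx₀))
  have hxU : φ p₀ ∈ U := mem_of_mem_nhds hU
  have hcont : ContinuousAt α (0, φ p₀) := hα.continuousOn.continuousAt
    (prod_mem_nhds (Ioo_mem_nhds (by linarith) hε) hU)
  have hαW : ∀ᶠ q : ℝ × E in 𝓝 (0, φ p₀), α q ∈ W := by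
    refine hcont.eventually_mem ?_
    rw [(hαd _ hxU).1]
    exact hWo.mem_nhds hxW
  rw [Filter.Eventually, mem_nhds_prod_iff'] at hαW
  obtain ⟨A, B, hA, h0A, hB, hxB, hAB⟩ := hαW
  obtain ⟨δ, hδ, hδA⟩ := Metric.isOpen_iff.1 hA 0 h0A
  have hIoo : ∀ t ∈ Ioo (-min δ ε) (min δ ε), t ∈ A ∧ t ∈ Ioo (-ε) ε := by
    intro t ht
    rw [mem_Ioo, ← abs_lt, lt_min_iff] at ht
    exact ⟨hδA (by simpa using ht.1), abs_lt.1 ht.2⟩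
  have hmemW : ∀ t ∈ Ioo (-min δ ε) (min δ ε), ∀ x ∈ B, α (t, x) ∈ W := fun t ht x hx =>
    hAB (show (t, x) ∈ A ×ˢ B from ⟨(hIoo t ht).1, hx⟩)
  refine ⟨min δ ε, lt_min hδ hε, φ.source ∩ φ ⁻¹' (U ∩ B), ?_, fun q => φ.symm (α (q.1, φ q.2)),
    ?_, ?_⟩
  · exact Filter.inter_mem (extChartAt_source_mem_nhds p₀)
      ((continuousAt_extChartAt p₀).preimage_mem_nhds (Filter.inter_mem hU (hB.mem_nhds hxB)))
  · have h1 : ContMDiffOn (𝓘(ℝ, ℝ).prod I) 𝓘(ℝ, ℝ × E) n (fun q : ℝ × N => (q.1, φ q.2))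
        (Ioo (-min δ ε) (min δ ε) ×ˢ (φ.source ∩ φ ⁻¹' (U ∩ B))) := by
      refine ContMDiffOn.prodMk_space contMDiffOn_fst ?_
      refine ((contMDiffOn_extChartAt (I := I) (x := p₀) (n := n)).comp contMDiffOn_snd ?_)
      intro q hq
      have := hq.2.1
      rwa [hφ, extChartAt_source] at this
    have h2 : ContMDiffOn (𝓘(ℝ, ℝ).prod I) 𝓘(ℝ, E) n (fun q : ℝ × N => α (q.1, φ q.2))
        (Ioo (-min δ ε) (min δ ε) ×ˢ (φ.source ∩ φ ⁻¹' (U ∩ B))) :=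
      hα.contMDiffOn.comp h1 fun q hq => ⟨(hIoo _ hq.1).2, hq.2.2.1⟩
    exact (contMDiffOn_extChartAt_symm (n := n) p₀).comp h2 fun q hq =>
      (hW (hmemW _ hq.1 _ hq.2.2.2)).2
  · intro p hp
    refine ⟨?_, fun t ht => ?_⟩
    · simp only [(hαd _ hp.2.1).1]
      exact φ.left_inv hp.1
    · have hm := hW (hmemW t ht _ hp.2.2)
      refine (hasMFDerivAt_of_hasDerivAt_extChartAt (V := V) p₀ hm.2 ?_).hasMFDerivWithinAt
      have := (hαd _ hp.2.1).2 t (hIoo t ht).2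
      rwa [show f (α (t, φ p)) = _ from hm.1] at this

end LocalFlow

/-! ### Global flows -/

section GlobalFlow

variable {E H N : Type*} [NormedAddCommGroup E] [NormedSpace ℝ E] [FiniteDimensional ℝ E]
  [TopologicalSpace H]
  {I : ModelWithCorners ℝ E H} [I.Boundaryless] [TopologicalSpace N] [ChartedSpace H N]
  [IsManifold I ∞ N]

/-- Around `p₀`, the vector field `V` has a flow of class `C^n` that exists for all times in
`(-ε, ε)`. -/
def HasLocalFlow (V : ∀ p : N, TangentSpace I p) (n : ℕ) (ε : ℝ) (p₀ : N) : Prop :=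
  ∃ U ∈ 𝓝 p₀, ∃ θ : ℝ × N → N,
    ContMDiffOn (𝓘(ℝ, ℝ).prod I) I n θ (Ioo (-ε) ε ×ˢ U) ∧
    ∀ p ∈ U, θ (0, p) = p ∧ IsMIntegralCurveOn (fun t => θ (t, p)) V (Ioo (-ε) ε)

lemma HasLocalFlow.mono {V : ∀ p : N, TangentSpace I p} {n : ℕ} {ε ε' : ℝ} {p₀ : N}
    (h : HasLocalFlow V n ε p₀) (hε : ε' ≤ ε) : HasLocalFlow V n ε' p₀ := by
  obtain ⟨U, hU, θ, hθ, hd⟩ := h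
  have hs : Ioo (-ε') ε' ⊆ Ioo (-ε) ε := Ioo_subset_Ioo (by linarith) hε
  exact ⟨U, hU, θ, hθ.mono (prod_mono hs le_rfl), fun p hp => ⟨(hd p hp).1, (hd p hp).2.mono hs⟩⟩

lemma exists_hasLocalFlow_of_isCompact {V : ∀ p : N, TangentSpace I p}
    (hV : ContMDiff I I.tangent ∞ (fun p => (⟨p, V p⟩ : TangentBundle I N)))
    {n : ℕ} (hn : 1 ≤ n) {C : Set N} (hC : IsCompact C) :
    ∃ ε > 0, ∀ p ∈ C, HasLocalFlow V n ε p := by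
  refine hC.induction_on (p := fun S => ∃ ε > 0, ∀ p ∈ S, HasLocalFlow V n ε p)
    ⟨1, one_pos, by simp⟩ ?_ ?_ ?_
  · rintro s t hst ⟨ε, hε, h⟩
    exact ⟨ε, hε, fun p hp => h p (hst hp)⟩
  · rintro s t ⟨ε, hε, h⟩ ⟨ε', hε', h'⟩
    refine ⟨min ε ε', lt_min hε hε', fun p hp => ?_⟩
    rcases hp with hp | hp
    · exact (h p hp).mono (min_le_left _ _)
    · exact (h' p hp).mono (min_le_right _ _)
  · intro p _
    obtain ⟨ε, hε, U, hU, θ, hθ⟩ := exists_contMDiffOn_local_flow hV hn p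
    refine ⟨interior U, mem_nhdsWithin_of_mem_nhds (interior_mem_nhds.2 hU), ε, hε, fun q hq => ?_⟩
    exact ⟨U, mem_interior_iff_mem_nhds.1 hq, θ, hθ⟩

variable [T2Space N]

/-- The group law of a global flow. -/
lemma IsMIntegralCurve.flow_add {V : ∀ p : N, TangentSpace I p}
    (hV : ContMDiff I I.tangent ∞ (fun p => (⟨p, V p⟩ : TangentBundle I N)))
    {Θ : ℝ × N → N} (h0 : ∀ p, Θ (0, p) = p) (hΘ : ∀ p, IsMIntegralCurve (fun t => Θ (t, p)) V)
    (s t : ℝ) (p : N) : Θ (s + t, p) = Θ (s, Θ (t, p)) := by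
  have h1 := (hΘ p).comp_add t
  have := isMIntegralCurve_Ioo_eq_of_contMDiff_boundaryless (t₀ := 0)
    (hV.of_le (by exact_mod_cast le_top)) h1 (hΘ (Θ (t, p))) (by simp [h0])
  exact congrFun this s

/-- A smooth vector field whose local flows of each class `C^n` exist for a time that is uniform on
the manifold has a smooth global flow. -/
theorem exists_contMDiff_global_flow {V : ∀ p : N, TangentSpace I p}
    (hV : ContMDiff I I.tangent ∞ (fun p => (⟨p, V p⟩ : TangentBundle I N)))
    (hloc : ∀ n : ℕ, 1 ≤ n → ∃ ε > 0, ∀ p, HasLocalFlow V n ε p) :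
    ∃ Θ : ℝ × N → N, ContMDiff (𝓘(ℝ, ℝ).prod I) I ∞ Θ ∧ (∀ p, Θ (0, p) = p) ∧
      ∀ p, IsMIntegralCurve (fun t => Θ (t, p)) V := by
  have hV1 : ContMDiff I I.tangent 1 (fun p => (⟨p, V p⟩ : TangentBundle I N)) :=
    hV.of_le (by exact_mod_cast le_top)
  have hex : ∀ p : N, ∃ γ : ℝ → N, γ 0 = p ∧ IsMIntegralCurve γ V := by
    obtain ⟨ε, hε, h⟩ := hloc 1 le_rfl
    intro p
    refine exists_isMIntegralCurve_of_isMIntegralCurveOn hV1 hε (fun q => ?_) p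
    obtain ⟨U, hU, θ, _, hd⟩ := h q
    exact ⟨fun t => θ (t, q), hd q (mem_of_mem_nhds hU)⟩
  choose γ hγ0 hγ using hex
  set Θ : ℝ × N → N := fun q => γ q.2 q.1 with hΘ
  have h0 : ∀ p, Θ (0, p) = p := hγ0
  have hc : ∀ p, IsMIntegralCurve (fun t => Θ (t, p)) V := hγ
  refine ⟨Θ, ?_, h0, hc⟩
  rw [contMDiff_infty]
  intro n
  suffices h : ContMDiff (𝓘(ℝ, ℝ).prod I) I (max n 1 : ℕ) Θ from
    h.of_le (by exact_mod_cast le_max_left n 1)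
  set m := max n 1
  obtain ⟨ε, hε, h⟩ := hloc m (le_max_right n 1)
  -- `Θ` is of class `C^m` for small times
  have hsmall : ∀ t ∈ Ioo (-ε) ε, ∀ p, ContMDiffAt (𝓘(ℝ, ℝ).prod I) I m Θ (t, p) := by
    intro t ht p
    obtain ⟨U, hU, θ, hθ, hd⟩ := h p
    have hnhds : Ioo (-ε) ε ×ˢ U ∈ 𝓝 (t, p) := prod_mem_nhds (Ioo_mem_nhds ht.1 ht.2) hU
    refine (hθ.contMDiffAt hnhds).congr_of_eventuallyEq ?_
    filter_upwards [hnhds] with q hq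
    exact isMIntegralCurveOn_Ioo_eqOn_of_contMDiff_boundaryless (t₀ := 0)
      ⟨by linarith, hε⟩ hV1 ((hc q.2).isMIntegralCurveOn _) (hd q.2 hq.2).2
      (by rw [h0, (hd q.2 hq.2).1]) hq.1
  -- the group law propagates smoothness
  have hstep : ∀ s, (∀ p, ContMDiffAt (𝓘(ℝ, ℝ).prod I) I m Θ (s, p)) →
      ∀ t ∈ Ioo (s - ε) (s + ε), ∀ p, ContMDiffAt (𝓘(ℝ, ℝ).prod I) I m Θ (t, p) := by
    intro s hs t ht p
    have h1 : ContMDiffAt I I m (fun p' => Θ (s, p')) p :=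
      (hs p).comp p (contMDiffAt_const.prodMk contMDiffAt_id)
    have h2 : ContMDiffAt (𝓘(ℝ, ℝ).prod I) (𝓘(ℝ, ℝ).prod I) m
        (fun q : ℝ × N => (q.1 - s, Θ (s, q.2))) (t, p) := by
      refine ContMDiffAt.prodMk ?_ (ContMDiffAt.comp (t, p) (g := fun p' => Θ (s, p')) h1
        contMDiffAt_snd)
      exact (contDiff_id.sub contDiff_const).contMDiff.contMDiffAt.comp (t, p) contMDiffAt_fst
    have h3 := ContMDiffAt.comp (t, p) (g := Θ)
      (hsmall (t - s) ⟨by linarith [ht.1], by linarith [ht.2]⟩ (Θ (s, p))) h2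
    refine h3.congr_of_eventuallyEq (Filter.Eventually.of_forall fun q => ?_)
    have := IsMIntegralCurve.flow_add hV h0 hc (q.1 - s) s q.2
    simpa using this
  have hall : ∀ k : ℕ, ∀ t, |t| < (k + 1) * (ε / 2) →
      ∀ p, ContMDiffAt (𝓘(ℝ, ℝ).prod I) I m Θ (t, p) := by
    intro k
    induction k with
    | zero =>
      intro t ht
      rw [Nat.cast_zero, zero_add, one_mul, abs_lt] at ht
      exact hsmall t ⟨by linarith, by linarith⟩
    | succ k ih =>
      intro t ht
      rw [Nat.cast_add, Nat.cast_one, abs_lt] at ht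
      by_cases h1 : 0 ≤ t
      · by_cases h2 : t < (k + 1) * (ε / 2)
        · exact ih t (by rw [abs_of_nonneg h1]; exact h2)
        · have hk : (0 : ℝ) ≤ k * (ε / 2) := by positivity
          -- `t - 3ε/4` is within `ε` of `t` and is covered by the induction hypothesis.
          refine hstep (t - 3 * ε / 4) (ih _ ?_) t ⟨by linarith, by linarith⟩
          rw [abs_lt]
          constructor <;> nlinarith
      · by_cases h2 : -t < (k + 1) * (ε / 2)
        · exact ih t (by rw [abs_of_neg (not_le.1 h1)]; exact h2)
        · have hk : (0 : ℝ) ≤ k * (ε / 2) := by positivity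
          refine hstep (t + 3 * ε / 4) (ih _ ?_) t ⟨by linarith, by linarith⟩
          rw [abs_lt]
          constructor <;> nlinarith
  intro q
  obtain ⟨k, hk⟩ := exists_nat_gt (|q.1| / (ε / 2))
  refine hall k q.1 ?_ q.2
  rw [div_lt_iff₀ (by positivity)] at hk
  nlinarith

end GlobalFlow

/-! ### Time-dependent vector fields -/

section TimeDependent

variable {E H N : Type*} [NormedAddCommGroup E] [NormedSpace ℝ E] [TopologicalSpace H]
  {I : ModelWithCorners ℝ E H} [TopologicalSpace N] [ChartedSpace H N]

/-- The vector field `∂_t + X_t` on `ℝ × N` associated with a time-dependent vector field. -/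
def suspension (X : ℝ → ∀ p : N, TangentSpace I p) (q : ℝ × N) :
    TangentSpace (𝓘(ℝ, ℝ).prod I) q := ((1 : ℝ), X q.1 q.2)

lemma hasMFDerivAt_prodMk_curve {a : ℝ → ℝ} {γ : ℝ → N} {t a' : ℝ} {v : TangentSpace I (γ t)}
    (ha : HasDerivAt a a' t)
    (hγ : HasMFDerivAt 𝓘(ℝ, ℝ) I γ t ((1 : ℝ →L[ℝ] ℝ).smulRight v)) :
    HasMFDerivAt 𝓘(ℝ, ℝ) (𝓘(ℝ, ℝ).prod I) (fun s => (a s, γ s)) t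
      ((1 : ℝ →L[ℝ] ℝ).smulRight ((a', v) : ℝ × E)) := by
  have h1 := ha.hasFDerivAt.hasMFDerivAt.prodMk hγ
  refine h1.congr_mfderiv ?_
  refine ContinuousLinearMap.ext_ring ?_
  change ((1 : ℝ) • a', (1 : ℝ) • v) = (1 : ℝ) • ((a', v) : ℝ × E)
  rfl

lemma suspension_flow_fst {X : ℝ → ∀ p : N, TangentSpace I p} {γ : ℝ → ℝ × N}
    (hγ : IsMIntegralCurve γ (suspension X)) (t : ℝ) : (γ t).1 = (γ 0).1 + t := by
  have hd : ∀ t, HasDerivAt (fun s => (γ s).1) 1 t := by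
    intro t
    have h1 : HasMFDerivAt 𝓘(ℝ, ℝ) 𝓘(ℝ, ℝ) (fun s => (γ s).1) t
        (ContinuousLinearMap.toSpanSingleton ℝ (1 : ℝ)) := by
      refine ((hasMFDerivAt_fst (I := 𝓘(ℝ, ℝ)) (I' := I) (γ t)).comp t (hγ t)).congr_mfderiv ?_
      exact ContinuousLinearMap.ext_ring rfl
    exact hasDerivAt_iff_hasFDerivAt.2 h1.hasFDerivAt
  have h1 : ∀ t, HasDerivAt (fun s => (γ s).1 - s) 0 t := fun t => by
    have h := (hd t).sub (hasDerivAt_id' t)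
    rw [sub_self] at h
    exact h
  have h2 := is_const_of_deriv_eq_zero (fun t => (h1 t).differentiableAt)
    (fun t => (h1 t).deriv) t 0
  simp only [sub_zero] at h2
  linarith

/-- The second component of an integral curve of `∂_t + X_t` that starts at time `0` is an integral
curve of the time-dependent vector field `X_t`. -/
lemma suspension_flow_snd {X : ℝ → ∀ p : N, TangentSpace I p} {γ : ℝ → ℝ × N}
    (hγ : IsMIntegralCurve γ (suspension X)) (h0 : (γ 0).1 = 0) (t : ℝ) :
    HasMFDerivAt 𝓘(ℝ, ℝ) I (fun s => (γ s).2) t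
      ((1 : ℝ →L[ℝ] ℝ).smulRight (X t (γ t).2)) := by
  have h1 := (hasMFDerivAt_snd (I := 𝓘(ℝ, ℝ)) (I' := I) (γ t)).comp t (hγ t)
  refine h1.congr_mfderiv ?_
  refine ContinuousLinearMap.ext_ring ?_
  change (1 : ℝ) • X (γ t).1 (γ t).2 = (1 : ℝ) • X t (γ t).2
  rw [suspension_flow_fst hγ t, h0, zero_add]

variable [I.Boundaryless] [IsManifold I ∞ N]

lemma vectorFieldInChart_suspension (X : ℝ → ∀ p : N, TangentSpace I p) (t₀ : ℝ) (x : N)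
    {z : ℝ × E} (hz : z.2 ∈ (extChartAt I x).target) :
    vectorFieldInChart (I := 𝓘(ℝ, ℝ).prod I) (suspension X) (t₀, x) z =
      ((1 : ℝ), vectorFieldInChart (X z.1) x z.2) := by
  have hq : (extChartAt I x).symm z.2 ∈ (chartAt H x).source := by
    rw [← extChartAt_source I]
    exact (extChartAt I x).map_target hz
  set q : ℝ × N := (z.1, (extChartAt I x).symm z.2)
  have hf : HasMFDerivAt (𝓘(ℝ, ℝ).prod I) 𝓘(ℝ, ℝ) (Prod.fst : ℝ × N → ℝ) q
      (ContinuousLinearMap.fst ℝ ℝ E) := hasMFDerivAt_fst q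
  have hg : HasMFDerivAt (𝓘(ℝ, ℝ).prod I) 𝓘(ℝ, E) (fun q : ℝ × N => extChartAt I x q.2) q
      ((mfderiv I 𝓘(ℝ, E) (extChartAt I x) q.2).comp (ContinuousLinearMap.snd ℝ ℝ E)) :=
    HasMFDerivAt.comp q (mdifferentiableAt_extChartAt hq).hasMFDerivAt (hasMFDerivAt_snd q)
  have h1 : HasMFDerivAt (𝓘(ℝ, ℝ).prod I) 𝓘(ℝ, ℝ × E)
      (fun q : ℝ × N => (q.1, extChartAt I x q.2)) q
      ((ContinuousLinearMap.fst ℝ ℝ E).prod ((mfderiv I 𝓘(ℝ, E) (extChartAt I x)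
        ((extChartAt I x).symm z.2)).comp (ContinuousLinearMap.snd ℝ ℝ E))) :=
    ⟨hf.1.prodMk hg.1, hf.2.prodMk hg.2⟩
  rw [vectorFieldInChart, extChartAt_prod, extChartAt_model_space_eq_id]
  exact congrArg (fun L => L (suspension X (z.1, (extChartAt I x).symm z.2))) h1.mfderiv

lemma contMDiff_suspension {X : ℝ → ∀ p : N, TangentSpace I p}
    (hX : ∀ x, ContDiffOn ℝ ∞ (fun z : ℝ × E => vectorFieldInChart (X z.1) x z.2)
      (univ ×ˢ (extChartAt I x).target)) :
    ContMDiff (𝓘(ℝ, ℝ).prod I) (𝓘(ℝ, ℝ).prod I).tangent ∞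
      (fun q : ℝ × N => (⟨q, suspension X q⟩ : TangentBundle (𝓘(ℝ, ℝ).prod I) (ℝ × N))) := by
  refine contMDiff_vectorField_iff.2 ?_
  rintro ⟨t₀, x⟩
  have ht : (extChartAt (𝓘(ℝ, ℝ).prod I) (t₀, x)).target = univ ×ˢ (extChartAt I x).target := by
    rw [extChartAt_prod, extChartAt_model_space_eq_id]
    rfl
  rw [ht]
  exact (contDiffOn_const.prodMk (hX x)).congr fun z hz => vectorFieldInChart_suspension X t₀ x hz.2

variable [FiniteDimensional ℝ E] [T2Space N]

/-- A smooth time-dependent vector field with compact support in `ℝ × N` has a smooth flow. -/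
theorem exists_flow_suspension {X : ℝ → ∀ p : N, TangentSpace I p}
    (hX : ContMDiff (𝓘(ℝ, ℝ).prod I) (𝓘(ℝ, ℝ).prod I).tangent ∞
      (fun q : ℝ × N => (⟨q, suspension X q⟩ : TangentBundle (𝓘(ℝ, ℝ).prod I) (ℝ × N))))
    {C : Set (ℝ × N)} (hC : IsCompact C) (hXC : ∀ q ∉ C, X q.1 q.2 = 0) :
    ∃ Θ : ℝ × (ℝ × N) → ℝ × N,
      ContMDiff (𝓘(ℝ, ℝ).prod (𝓘(ℝ, ℝ).prod I)) (𝓘(ℝ, ℝ).prod I) ∞ Θ ∧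
      (∀ q, Θ (0, q) = q) ∧ ∀ q, IsMIntegralCurve (fun t => Θ (t, q)) (suspension X) := by
  refine exists_contMDiff_global_flow hX fun n hn => ?_
  obtain ⟨R, hR⟩ := (hC.image continuous_fst).isBounded.subset_closedBall (0 : ℝ)
  -- From a point outside this larger set, `∂_t + X_t` does not meet the support of `X` for one unit
  -- of time, so that its flow is a translation in the `ℝ`-direction.
  set C' : Set (ℝ × N) := Metric.closedBall (0 : ℝ) (R + 1) ×ˢ (Prod.snd '' C)
  have hC' : IsCompact C' := (isCompact_closedBall _ _).prod (hC.image continuous_snd)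
  obtain ⟨ε, hε, h⟩ := exists_hasLocalFlow_of_isCompact hX hn hC'
  refine ⟨min ε 1, lt_min hε one_pos, fun q => ?_⟩
  by_cases hq : q ∈ C'
  · exact (h q hq).mono (min_le_left _ _)
  · refine HasLocalFlow.mono ?_ (min_le_right ε 1)
    refine ⟨C'ᶜ, hC'.isClosed.isOpen_compl.mem_nhds hq, fun r => (r.2.1 + r.1, r.2.2), ?_, ?_⟩
    · refine ContMDiff.contMDiffOn (ContMDiff.prodMk ?_ (contMDiff_snd.comp contMDiff_snd))
      exact (contDiff_fst.add contDiff_snd).contMDiff.comp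
        ((contMDiff_fst.comp contMDiff_snd).prodMk_space contMDiff_fst)
    · intro p hp
      refine ⟨by simp, fun t ht => HasMFDerivAt.hasMFDerivWithinAt ?_⟩
      have hz : X (p.1 + t) p.2 = 0 := by
        refine hXC (p.1 + t, p.2) fun hmem => hp ⟨?_, ⟨_, hmem, rfl⟩⟩
        have h1 := hR ⟨_, hmem, rfl⟩
        rw [mem_closedBall_zero_iff, Real.norm_eq_abs, abs_le] at h1 ⊢
        simp only at h1
        constructor <;> linarith [ht.1, ht.2, h1.1, h1.2]
      have hd : HasDerivAt (fun s : ℝ => p.1 + s) 1 t := (hasDerivAt_id t).const_add p.1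
      have h2 := hasMFDerivAt_prodMk_curve (I := I) (γ := fun _ => p.2) (v := X (p.1 + t) p.2) hd
        (by
          rw [hz]
          refine (hasMFDerivAt_const p.2 t).congr_mfderiv ?_
          refine ContinuousLinearMap.ext_ring ?_
          exact (smul_zero (1 : ℝ)).symm)
      exact h2

end TimeDependent

/-! ### The exterior derivative of 1-forms on normed spaces -/

section Alternation

variable {E F : Type*} [NormedAddCommGroup E] [NormedSpace ℝ E] [NormedAddCommGroup F]
  [NormedSpace ℝ F]

/-- The exterior derivative `(v, w) ↦ D_v b (w) - D_w b (v)` at `y` of the 1-form `b` on a normed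
space, as a continuous bilinear map. -/
def extDerivOneForm (b : E → E →L[ℝ] ℝ) (y : E) : E →L[ℝ] E →L[ℝ] ℝ :=
  fderiv ℝ b y - (fderiv ℝ b y).flip

lemma extDerivOneForm_apply (b : E → E →L[ℝ] ℝ) (y v w : E) :
    extDerivOneForm b y v w = fderiv ℝ b y v w - fderiv ℝ b y w v := rfl

lemma extDerivOneForm_congr {b b' : E → E →L[ℝ] ℝ} {y : E} (h : b =ᶠ[𝓝 y] b') :
    extDerivOneForm b y = extDerivOneForm b' y := by
  rw [extDerivOneForm, extDerivOneForm, h.fderiv_eq]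

lemma extDerivOneForm_const_smul (c : ℝ) {b : E → E →L[ℝ] ℝ} {y : E}
    (hb : DifferentiableAt ℝ b y) (v w : E) :
    extDerivOneForm (fun z => c • b z) y v w = c * extDerivOneForm b y v w := by
  rw [extDerivOneForm_apply, extDerivOneForm_apply, fderiv_fun_const_smul hb]
  simp [mul_sub]

lemma extDerivOneForm_sub {b b' : E → E →L[ℝ] ℝ} {y : E} (hb : DifferentiableAt ℝ b y)
    (hb' : DifferentiableAt ℝ b' y) (v w : E) :
    extDerivOneForm (fun z => b z - b' z) y v w =
      extDerivOneForm b y v w - extDerivOneForm b' y v w := by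
  simp only [extDerivOneForm_apply]
  rw [fderiv_fun_sub hb hb']
  simp only [sub_apply]
  ring

lemma ContDiffOn.extDerivOneForm [FiniteDimensional ℝ E] {b : E → E →L[ℝ] ℝ} {s : Set E}
    (hs : IsOpen s) (hb : ContDiffOn ℝ ∞ b s) : ContDiffOn ℝ ∞ (extDerivOneForm b) s := by
  have h := hb.fderiv_of_isOpen hs (m := ∞) (by exact_mod_cast le_rfl)
  have h2 : ∀ v w : E, ContDiffOn ℝ ∞ (fun y => fderiv ℝ b y v w) s := fun v w =>
    (h.clm_apply contDiffOn_const).clm_apply contDiffOn_const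
  refine contDiffOn_clm_apply.2 fun v => contDiffOn_clm_apply.2 fun w => ?_
  exact (h2 v w).sub (h2 w v)

/-- Exterior derivative commutes with pullback: the second derivative of `g` drops out by
symmetry. -/
lemma extDerivOneForm_pullback {b : F → F →L[ℝ] ℝ} {g : E → F} {y : E}
    (hb : DifferentiableAt ℝ b (g y)) (hg : ContDiffAt ℝ ∞ g y) (v w : E) :
    extDerivOneForm (fun z => (b (g z)).comp (fderiv ℝ g z)) y v w =
      extDerivOneForm b (g y) (fderiv ℝ g y v) (fderiv ℝ g y w) := by
  have hgd : DifferentiableAt ℝ g y := hg.differentiableAt (by simp)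
  have hg2 : DifferentiableAt ℝ (fderiv ℝ g) y :=
    (hg.fderiv_right (m := ∞) (by exact_mod_cast le_rfl)).differentiableAt (by simp)
  have h1 : HasFDerivAt (fun z => b (g z)) ((fderiv ℝ b (g y)).comp (fderiv ℝ g y)) y :=
    hb.hasFDerivAt.comp y hgd.hasFDerivAt
  have h2 := h1.clm_comp hg2.hasFDerivAt
  have hsymm : fderiv ℝ (fderiv ℝ g) y v w = fderiv ℝ (fderiv ℝ g) y w v :=
    (hg.isSymmSndFDerivAt (by simpa using ENat.LEInfty.out)).eq v w
  rw [extDerivOneForm_apply, extDerivOneForm_apply, h2.fderiv]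
  simp [hsymm]

end Alternation

/-! ### 1-forms on manifolds -/

section Forms

variable {E H N : Type*} [NormedAddCommGroup E] [NormedSpace ℝ E] [TopologicalSpace H]
  {I : ModelWithCorners ℝ E H} [I.Boundaryless] [TopologicalSpace N] [ChartedSpace H N]
  [IsManifold I ∞ N]
  {E₁ : Type*} [NormedAddCommGroup E₁] [NormedSpace ℝ E₁]

/-- The pullback of the 1-form `β` by a map `u` defined on a normed space. -/
def CovectorField.pull (β : CovectorField (N := N) I) (u : E₁ → N) (y : E₁) : E₁ →L[ℝ] ℝ :=
  (β (u y)).comp (mfderiv 𝓘(ℝ, E₁) I u y)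

/-- A 1-form is smooth if it is smooth in all charts. -/
def CovectorField.IsSmooth (β : CovectorField (N := N) I) : Prop :=
  ∀ x, ContDiffOn ℝ ∞ (β.pull (extChartAt I x).symm) (extChartAt I x).target

namespace CovectorField

lemma pull_extChartAt_symm_self (β : CovectorField (N := N) I) (p : N) (v : E) :
    β.pull (extChartAt I p).symm (extChartAt I p p) v = β p v := by
  have hsymm : mfderiv 𝓘(ℝ, E) I (extChartAt I p).symm (extChartAt I p p) =
      ContinuousLinearMap.id ℝ _ := by
    have := mfderivWithin_range_extChartAt_symm (I := I) (x := p)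
    rwa [I.range_eq_univ, mfderivWithin_univ] at this
  have h : ∀ q : N, q = p → β q (v : E) = β p (v : E) := by
    rintro q rfl
    rfl
  rw [pull, hsymm]
  exact h _ (extChartAt_to_inv p)

lemma IsSmooth.contDiffAt {β : CovectorField (N := N) I} (hβ : β.IsSmooth) (x : N) {y : E}
    (hy : y ∈ (extChartAt I x).target) : ContDiffAt ℝ ∞ (β.pull (extChartAt I x).symm) y :=
  (hβ x).contDiffAt ((isOpen_extChartAt_target x).mem_nhds hy)

lemma d_eq {β : CovectorField (N := N) I} (hβ : β.IsSmooth) (p : N) (v w : TangentSpace I p) :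
    β.d p v w = extDerivOneForm (β.pull (extChartAt I p).symm) (extChartAt I p p) v w := by
  set b := β.pull (extChartAt I p).symm
  set y := extChartAt I p p
  have hb : DifferentiableAt ℝ b y :=
    (hβ.contDiffAt p (mem_extChartAt_target p)).differentiableAt (by simp)
  have hd : DifferentiableAt ℝ (β.inChart p) y :=
    (ContinuousAlternatingMap.ofSubsingletonLIE (𝕜 := ℝ) (E := E) (F := ℝ)
      (0 : Fin 1)).toContinuousLinearEquiv.differentiable.differentiableAt.comp y hb
  have hf : ∀ v w : E, fderiv ℝ (fun z => b z v) y w = fderiv ℝ b y w v := fun v w => by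
    rw [fderiv_clm_apply hb (differentiableAt_const v)]
    simp
  have key : ∀ v w : E, extDeriv (β.inChart p) y ![v, w] = extDerivOneForm b y v w := fun v w => by
    rw [extDeriv_apply hd, extDerivOneForm_apply, ← hf, ← hf, Fin.sum_univ_two]
    simp only [Fin.val_zero, Fin.val_one, pow_zero, pow_one, one_smul, neg_smul, ← sub_eq_add_neg]
    rfl
  exact key v w

lemma pull_eventuallyEq (β : CovectorField (N := N) I) {u : E₁ → N} {W : Set E₁} (hW : IsOpen W)
    (hu : ContMDiffOn 𝓘(ℝ, E₁) I ∞ u W) (x : N) {y : E₁} (hy : y ∈ W)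
    (hx : u y ∈ (extChartAt I x).source) :
    ∀ᶠ z in 𝓝 y, β.pull u z = (β.pull (extChartAt I x).symm (extChartAt I x (u z))).comp
      (fderiv ℝ (fun z => extChartAt I x (u z)) z) := by
  have hcont : ContinuousAt u y := hu.continuousOn.continuousAt (hW.mem_nhds hy)
  have hopen := isOpen_extChartAt_source (I := I) x
  filter_upwards [(hcont.eventually_mem (hopen.mem_nhds hx)).eventually_nhds,
    hW.mem_nhds hy] with z hz hzW
  have hzs : u z ∈ (extChartAt I x).source := hz.self_of_nhds
  have hud : MDifferentiableAt 𝓘(ℝ, E₁) I u z :=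
    (hu.contMDiffAt (hW.mem_nhds hzW)).mdifferentiableAt (by simp)
  have hφd : MDifferentiableAt I 𝓘(ℝ, E) (extChartAt I x) (u z) :=
    mdifferentiableAt_extChartAt (by rwa [extChartAt_source] at hzs)
  have h1 : mfderiv 𝓘(ℝ, E₁) 𝓘(ℝ, E) (fun z => extChartAt I x (u z)) z =
      (mfderiv I 𝓘(ℝ, E) (extChartAt I x) (u z)).comp (mfderiv 𝓘(ℝ, E₁) I u z) :=
    mfderiv_comp z hφd hud
  rw [← mfderiv_eq_fderiv, h1]
  ext v
  have hpt := (extChartAt I x).left_inv hzs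
  have h2 := mfderiv_extChartAt_symm_apply_mfderiv (I := I) x ((extChartAt I x).map_source hzs)
  change β (u z) (mfderiv 𝓘(ℝ, E₁) I u z v) = β ((extChartAt I x).symm (extChartAt I x (u z)))
    (mfderiv 𝓘(ℝ, E) I (extChartAt I x).symm (extChartAt I x (u z))
      (mfderiv I 𝓘(ℝ, E) (extChartAt I x) (u z) (mfderiv 𝓘(ℝ, E₁) I u z v)))
  rw [hpt] at h2 ⊢
  rw [h2]

lemma contDiffAt_extChartAt_comp {u : E₁ → N} {W : Set E₁} (hW : IsOpen W)
    (hu : ContMDiffOn 𝓘(ℝ, E₁) I ∞ u W) (x : N) {y : E₁} (hy : y ∈ W)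
    (hx : u y ∈ (extChartAt I x).source) : ContDiffAt ℝ ∞ (fun z => extChartAt I x (u z)) y := by
  rw [← contMDiffAt_iff_contDiffAt]
  exact (contMDiffAt_extChartAt' (by rwa [extChartAt_source] at hx)).comp y
    (hu.contMDiffAt (hW.mem_nhds hy))

lemma IsSmooth.contDiffOn_pull {β : CovectorField (N := N) I} (hβ : β.IsSmooth) {u : E₁ → N}
    {W : Set E₁} (hW : IsOpen W) (hu : ContMDiffOn 𝓘(ℝ, E₁) I ∞ u W) :
    ContDiffOn ℝ ∞ (β.pull u) W := by
  intro y hy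
  have hx : u y ∈ (extChartAt I (u y)).source := mem_extChartAt_source _
  have hg := contDiffAt_extChartAt_comp hW hu (u y) hy hx
  refine (ContDiffAt.congr_of_eventuallyEq ?_
    (pull_eventuallyEq β hW hu (u y) hy hx)).contDiffWithinAt
  refine ContDiffAt.clm_comp ?_ (hg.fderiv_right (by exact_mod_cast le_rfl))
  exact ContDiffAt.comp y (hβ.contDiffAt (u y) ((extChartAt I (u y)).map_source hx)) hg

/-- Exterior derivative commutes with pullback. -/
lemma extDerivOneForm_pull {β : CovectorField (N := N) I} (hβ : β.IsSmooth) {u : E₁ → N}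
    {W : Set E₁} (hW : IsOpen W) (hu : ContMDiffOn 𝓘(ℝ, E₁) I ∞ u W) {y : E₁} (hy : y ∈ W)
    (v w : E₁) :
    extDerivOneForm (β.pull u) y v w =
      β.d (u y) (mfderiv 𝓘(ℝ, E₁) I u y v) (mfderiv 𝓘(ℝ, E₁) I u y w) := by
  have hx : u y ∈ (extChartAt I (u y)).source := mem_extChartAt_source _
  have hg := contDiffAt_extChartAt_comp hW hu (u y) hy hx
  rw [extDerivOneForm_congr (pull_eventuallyEq β hW hu (u y) hy hx), extDerivOneForm_pullback
    (b := β.pull (extChartAt I (u y)).symm) (g := fun z => extChartAt I (u y) (u z))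
    ((hβ.contDiffAt (u y) ((extChartAt I (u y)).map_source hx)).differentiableAt (by simp)) hg,
    d_eq hβ]
  have h1 : mfderiv 𝓘(ℝ, E₁) 𝓘(ℝ, E) (fun z => extChartAt I (u y) (u z)) y =
      (mfderiv I 𝓘(ℝ, E) (extChartAt I (u y)) (u y)).comp (mfderiv 𝓘(ℝ, E₁) I u y) :=
    mfderiv_comp y (mdifferentiableAt_extChartAt (mem_chart_source _ _))
      ((hu.contMDiffAt (hW.mem_nhds hy)).mdifferentiableAt (by simp))
  rw [mfderiv_extChartAt_self] at h1
  rw [← mfderiv_eq_fderiv, h1]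
  rfl

/-- The pullback of a 1-form by a self-map of the manifold. -/
def pullback (β : CovectorField (N := N) I) (f : N → N) : CovectorField (N := N) I :=
  fun p => (β (f p)).comp (mfderiv I I f p)

lemma pull_pullback (β : CovectorField (N := N) I) {f : N → N} (hf : ContMDiff I I ∞ f)
    {u : E₁ → N} {y : E₁} (hu : MDifferentiableAt 𝓘(ℝ, E₁) I u y) :
    (β.pullback f).pull u y = β.pull (fun z => f (u z)) y := by
  have h : mfderiv 𝓘(ℝ, E₁) I (fun z => f (u z)) y =
      (mfderiv I I f (u y)).comp (mfderiv 𝓘(ℝ, E₁) I u y) :=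
    mfderiv_comp y ((hf (u y)).mdifferentiableAt (by simp)) hu
  rw [pull, pull, h]
  rfl

lemma IsSmooth.pullback {β : CovectorField (N := N) I} (hβ : β.IsSmooth) {f : N → N}
    (hf : ContMDiff I I ∞ f) : (β.pullback f).IsSmooth := by
  intro x
  refine (hβ.contDiffOn_pull (isOpen_extChartAt_target x)
    (hf.comp_contMDiffOn (contMDiffOn_extChartAt_symm x))).congr fun y hy => ?_
  exact pull_pullback β hf (mdifferentiableAt_extChartAt_symm x hy)

lemma d_pullback {β : CovectorField (N := N) I} (hβ : β.IsSmooth) {f : N → N}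
    (hf : ContMDiff I I ∞ f) (p : N) (v w : TangentSpace I p) :
    (β.pullback f).d p v w = β.d (f p) (mfderiv I I f p v) (mfderiv I I f p w) := by
  have hsymm : mfderiv 𝓘(ℝ, E) I (extChartAt I p).symm (extChartAt I p p) =
      ContinuousLinearMap.id ℝ _ := by
    have := mfderivWithin_range_extChartAt_symm (I := I) (x := p)
    rwa [I.range_eq_univ, mfderivWithin_univ] at this
  have hpt : (extChartAt I p).symm (extChartAt I p p) = p := extChartAt_to_inv p
  have hmem := mem_extChartAt_target (I := I) p
  have hev : (β.pullback f).pull (extChartAt I p).symm =ᶠ[𝓝 (extChartAt I p p)]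
      β.pull (fun z => f ((extChartAt I p).symm z)) := by
    filter_upwards [(isOpen_extChartAt_target p).mem_nhds hmem] with z hz
    exact pull_pullback β hf (mdifferentiableAt_extChartAt_symm p hz)
  rw [d_eq (hβ.pullback hf), extDerivOneForm_congr hev]
  refine (extDerivOneForm_pull hβ (u := fun z => f ((extChartAt I p).symm z))
    (isOpen_extChartAt_target p) (hf.comp_contMDiffOn (contMDiffOn_extChartAt_symm p)) hmem v
    w).trans ?_
  have h : mfderiv 𝓘(ℝ, E) I (fun z => f ((extChartAt I p).symm z)) (extChartAt I p p) =
      (mfderiv I I f ((extChartAt I p).symm (extChartAt I p p))).comp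
        (mfderiv 𝓘(ℝ, E) I (extChartAt I p).symm (extChartAt I p p)) :=
    mfderiv_comp _ ((hf _).mdifferentiableAt (by simp)) (mdifferentiableAt_extChartAt_symm p hmem)
  rw [h, hsymm, hpt]
  rfl

lemma d_const_smul {β : CovectorField (N := N) I} (hβ : β.IsSmooth) (c : ℝ) (p : N)
    (v w : TangentSpace I p) :
    CovectorField.d (fun q => c • β q : CovectorField (N := N) I) p v w = c * β.d p v w := by
  have hs : CovectorField.IsSmooth (fun q => c • β q : CovectorField (N := N) I) := fun x =>
    (hβ x).const_smul c
  rw [d_eq hs, d_eq hβ]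
  exact extDerivOneForm_const_smul c
    ((hβ.contDiffAt p (mem_extChartAt_target p)).differentiableAt (by simp)) v w

lemma IsSmooth.sub {β β' : CovectorField (N := N) I} (hβ : β.IsSmooth) (hβ' : β'.IsSmooth) :
    CovectorField.IsSmooth (fun q => β q - β' q : CovectorField (N := N) I) := fun x =>
  (hβ x).sub (hβ' x)

lemma d_sub {β β' : CovectorField (N := N) I} (hβ : β.IsSmooth) (hβ' : β'.IsSmooth) (p : N)
    (v w : TangentSpace I p) :
    CovectorField.d (fun q => β q - β' q : CovectorField (N := N) I) p v w =
      β.d p v w - β'.d p v w := by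
  rw [d_eq (hβ.sub hβ'), d_eq hβ, d_eq hβ']
  exact extDerivOneForm_sub
    ((hβ.contDiffAt p (mem_extChartAt_target p)).differentiableAt (by simp))
    ((hβ'.contDiffAt p (mem_extChartAt_target p)).differentiableAt (by simp)) v w

end CovectorField

end Forms

section Cotangent

variable {E M : Type*} [NormedAddCommGroup E] [NormedSpace ℝ E]
  [TopologicalSpace M] [ChartedSpace E M] [IsManifold 𝓘(ℝ, E) ∞ M]

/-- A smooth section of the cotangent bundle is smooth in all charts. -/
lemma CovectorField.isSmooth_of_contMDiff {α : CovectorField (N := M) 𝓘(ℝ, E)}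
    (hα : ContMDiff 𝓘(ℝ, E) (𝓘(ℝ, E).prod 𝓘(ℝ, E →L[ℝ] ℝ)) ∞
      (fun x => (⟨x, α x⟩ : CotangentSpace E M))) : α.IsSmooth := by
  intro x
  have key : ∀ p ∈ (chartAt E x).source,
      (trivializationAt (E →L[ℝ] ℝ) (fun x : M => TangentSpace 𝓘(ℝ, E) x →L[ℝ] ℝ) x ⟨p, α p⟩).2 =
        α.pull (extChartAt 𝓘(ℝ, E) x).symm (extChartAt 𝓘(ℝ, E) x p) := by
    intro p hp
    have h1 := TangentBundle.symmL_trivializationAt (I := 𝓘(ℝ, E)) hp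
    have h2 : (trivializationAt (E →L[ℝ] ℝ)
        (fun x : M => TangentSpace 𝓘(ℝ, E) x →L[ℝ] ℝ) x ⟨p, α p⟩).2 =
      (α p).comp (Trivialization.symmL ℝ (trivializationAt E (TangentSpace 𝓘(ℝ, E)) x) p) := by
      rw [hom_trivializationAt_apply]
      ext v
      simp [ContinuousLinearMap.inCoordinates]
    rw [h2, h1, CovectorField.pull, (extChartAt 𝓘(ℝ, E) x).left_inv (by rwa [extChartAt_source])]
    simp
  rw [← contMDiffOn_iff_contDiffOn]
  intro y hy
  set p := (extChartAt 𝓘(ℝ, E) x).symm y with hp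
  have hps : p ∈ (chartAt E x).source := by
    rw [← extChartAt_source 𝓘(ℝ, E)]; exact (extChartAt 𝓘(ℝ, E) x).map_target hy
  have h1 : ContMDiffAt 𝓘(ℝ, E) 𝓘(ℝ, E →L[ℝ] ℝ) ∞ (fun q =>
      (trivializationAt (E →L[ℝ] ℝ)
        (fun x : M => TangentSpace 𝓘(ℝ, E) x →L[ℝ] ℝ) x ⟨q, α q⟩).2) p := by
    refine (Trivialization.contMDiffAt_section_iff (trivializationAt (E →L[ℝ] ℝ)
      (fun x : M => TangentSpace 𝓘(ℝ, E) x →L[ℝ] ℝ) x) ?_).1 (hα p)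
    rw [hom_trivializationAt_baseSet]
    exact ⟨hps, mem_univ _⟩
  have h2 := ContMDiffWithinAt.comp y h1.contMDiffWithinAt
    (contMDiffOn_extChartAt_symm (I := 𝓘(ℝ, E)) (n := ∞) x y hy) (mapsTo_univ _ _)
  have h3 : ∀ z ∈ (extChartAt 𝓘(ℝ, E) x).target, α.pull (extChartAt 𝓘(ℝ, E) x).symm z =
      (trivializationAt (E →L[ℝ] ℝ) (fun x : M => TangentSpace 𝓘(ℝ, E) x →L[ℝ] ℝ) x
        ⟨(extChartAt 𝓘(ℝ, E) x).symm z, α ((extChartAt 𝓘(ℝ, E) x).symm z)⟩).2 := by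
    intro z hz
    rw [key _ (by rw [← extChartAt_source 𝓘(ℝ, E)]; exact (extChartAt 𝓘(ℝ, E) x).map_target hz),
      (extChartAt 𝓘(ℝ, E) x).right_inv hz]
  exact h2.congr h3 (h3 y hy)

end Cotangent

/-! ### The symplectization in the charts of the contact form -/

namespace ContactStructure

variable {E M : Type*} [NormedAddCommGroup E] [NormedSpace ℝ E]
  [TopologicalSpace M] [ChartedSpace E M] [IsManifold 𝓘(ℝ, E) ∞ M] {ξ : ContactStructure E M}

namespace Symplectization

lemma extChartAt_apply (p q : ξ.Symplectization) :
    extChartAt (symplModel E) p q =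
      ((coord ξ q).1, extChartAt 𝓘(ℝ, E) p.proj q.proj) := rfl

lemma extChartAt_source_eq (p : ξ.Symplectization) :
    (extChartAt (symplModel E) p).source = proj ⁻¹' (extChartAt 𝓘(ℝ, E) p.proj).source := by
  ext q
  simp [extChartAt, chartAt, ChartedSpace.chartAt, coord]
  rfl

lemma extChartAt_target_eq (p : ξ.Symplectization) :
    (extChartAt (symplModel E) p).target = univ ×ˢ (extChartAt 𝓘(ℝ, E) p.proj).target := by
  ext z
  simp only [extChartAt, chartAt, ChartedSpace.chartAt, coord, mfld_simps]
  exact ⟨fun h => h.2, fun h => ⟨mem_univ _, h⟩⟩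

lemma coord_ofCoord (q : ℝ × M) : coord ξ (ofCoord ξ q) = q := (coord ξ).apply_symm_apply q

lemma ofCoord_coord (p : ξ.Symplectization) : ofCoord ξ (coord ξ p) = p :=
  (coord ξ).symm_apply_apply p

lemma coord_translate (s : ℝ) (p : ξ.Symplectization) :
    coord ξ (p.translate s) = ((coord ξ p).1 + s, p.proj) := by
  have h : (p.translate s).ratio = Real.exp s * p.ratio := ratio_unique _ (by
    change Real.exp s • p.covector = (Real.exp s * p.ratio) • ξ.form p.proj
    rw [mul_smul, ← covector_eq])
  change (Real.log (p.translate s).ratio, p.proj) = (Real.log p.ratio + s, p.proj)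
  rw [h, Real.log_mul (Real.exp_pos s).ne' p.ratio_pos.ne', Real.log_exp, add_comm]

lemma translate_eq (s : ℝ) (p : ξ.Symplectization) :
    p.translate s = ofCoord ξ ((coord ξ p).1 + s, p.proj) := by
  rw [← coord_translate, ofCoord_coord]

lemma proj_translate (s : ℝ) (p : ξ.Symplectization) : (p.translate s).proj = p.proj := rfl

lemma translate_translate (s t : ℝ) (p : ξ.Symplectization) :
    (p.translate s).translate t = p.translate (s + t) := by
  apply (coord ξ).injective
  rw [coord_translate, coord_translate, coord_translate, add_assoc]
  rfl

lemma translate_zero (p : ξ.Symplectization) : p.translate 0 = p := by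
  apply (coord ξ).injective
  rw [coord_translate, add_zero]
  rfl

lemma contMDiff_coord : ContMDiff (symplModel E) (symplModel E) ∞ (coord ξ) := by
  intro p
  have h1 : ContMDiffAt (symplModel E) 𝓘(ℝ, ℝ × E) ∞ (extChartAt (symplModel E) p) p :=
    contMDiffAt_extChartAt
  have h2 : ContMDiffAt 𝓘(ℝ, ℝ × E) (symplModel E) ∞ (extChartAt (symplModel E) (coord ξ p)).symm
      (extChartAt (symplModel E) p p) :=
    (contMDiffOn_extChartAt_symm (coord ξ p)).contMDiffAt
      ((isOpen_extChartAt_target (coord ξ p)).mem_nhds (mem_extChartAt_target (coord ξ p)))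
  refine (h2.comp p h1).congr_of_eventuallyEq ?_
  filter_upwards [extChartAt_source_mem_nhds (I := symplModel E) p] with q hq
  rw [extChartAt_source_eq] at hq
  refine ((extChartAt (symplModel E) (coord ξ p)).left_inv ?_).symm
  rw [extChartAt_prod]
  exact ⟨by rw [extChartAt_source, chartAt_self_eq]; exact mem_univ _, hq⟩

lemma contMDiff_ofCoord : ContMDiff (symplModel E) (symplModel E) ∞ (ofCoord ξ) := by
  intro q
  have h1 : ContMDiffAt (symplModel E) 𝓘(ℝ, ℝ × E) ∞ (extChartAt (symplModel E) q) q :=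
    contMDiffAt_extChartAt
  have h2 : ContMDiffAt 𝓘(ℝ, ℝ × E) (symplModel E) ∞
      (extChartAt (symplModel E) (ofCoord ξ q)).symm (extChartAt (symplModel E) q q) := by
    refine (contMDiffOn_extChartAt_symm (ofCoord ξ q)).contMDiffAt
      ((isOpen_extChartAt_target (ofCoord ξ q)).mem_nhds ?_)
    rw [extChartAt_target_eq]
    exact ⟨mem_univ _, mem_extChartAt_target (I := 𝓘(ℝ, E)) q.2⟩
  refine (h2.comp q h1).congr_of_eventuallyEq ?_
  filter_upwards [extChartAt_source_mem_nhds (I := symplModel E) q] with r hr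
  rw [extChartAt_prod] at hr
  change ofCoord ξ r = ofCoord ξ (r.1, (extChartAt 𝓘(ℝ, E) q.2).symm (extChartAt 𝓘(ℝ, E) q.2 r.2))
  rw [(extChartAt 𝓘(ℝ, E) q.2).left_inv hr.2]

lemma contMDiff_proj :
    ContMDiff (symplModel E) 𝓘(ℝ, E) ∞ (proj : ξ.Symplectization → M) :=
  contMDiff_snd.comp contMDiff_coord

lemma contMDiff_translate_uncurry :
    ContMDiff (𝓘(ℝ, ℝ).prod (symplModel E)) (symplModel E) ∞
      (fun q : ℝ × ξ.Symplectization => q.2.translate q.1) := by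
  have h1 : ContMDiff (𝓘(ℝ, ℝ).prod (symplModel E)) (symplModel E) ∞
      (fun q : ℝ × ξ.Symplectization => coord ξ q.2) := contMDiff_coord.comp contMDiff_snd
  have h2 : ContMDiff (𝓘(ℝ, ℝ).prod (symplModel E)) 𝓘(ℝ, ℝ) ∞
      (fun q : ℝ × ξ.Symplectization => (coord ξ q.2).1 + q.1) :=
    (contDiff_fst.add contDiff_snd).contMDiff.comp
      ((contMDiff_fst.comp h1).prodMk_space contMDiff_fst)
  have h3 := (contMDiff_ofCoord (ξ := ξ)).comp (h2.prodMk (contMDiff_proj.comp contMDiff_snd))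
  exact h3.congr fun q => translate_eq (ξ := ξ) q.1 q.2

lemma contMDiff_translate (s : ℝ) :
    ContMDiff (symplModel E) (symplModel E) ∞ (translate (ξ := ξ) s) :=
  contMDiff_translate_uncurry.comp (contMDiff_const.prodMk contMDiff_id)

/-- The Liouville vector field of the symplectization, the generator of the `ℝ`-action. In all the
charts used here it is the first coordinate vector field. -/
def liouvilleField (p : ξ.Symplectization) : TangentSpace (symplModel E) p := ((1 : ℝ), (0 : E))

lemma hasMFDerivAt_translate (p : ξ.Symplectization) (s : ℝ) :
    HasMFDerivAt 𝓘(ℝ, ℝ) (symplModel E) (fun s => p.translate s) s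
      ((1 : ℝ →L[ℝ] ℝ).smulRight (liouvilleField (p.translate s))) := by
  have hc : ContMDiff 𝓘(ℝ, ℝ) (symplModel E) ∞ (fun s => p.translate s) :=
    contMDiff_translate_uncurry.comp (contMDiff_id.prodMk contMDiff_const)
  refine ⟨hc.continuous.continuousAt, ?_⟩
  have h : writtenInExtChartAt 𝓘(ℝ, ℝ) (symplModel E) s (fun s => p.translate s) =
      fun r => ((coord ξ p).1 + r, extChartAt 𝓘(ℝ, E) p.proj p.proj) := by
    funext r
    change ((coord ξ (p.translate r)).1, _) = _
    rw [coord_translate]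
    rfl
  rw [h]
  have h2 : HasDerivAt (fun r : ℝ => ((coord ξ p).1 + r, extChartAt 𝓘(ℝ, E) p.proj p.proj))
      ((1 : ℝ), (0 : E)) s := ((hasDerivAt_id s).const_add _).prodMk (hasDerivAt_const s _)
  refine (HasFDerivAt.congr_fderiv h2.hasFDerivAt ?_).hasFDerivWithinAt
  exact ContinuousLinearMap.ext_ring rfl

end Symplectization

open Symplectization

lemma form_isSmooth : ξ.form.IsSmooth :=
  CovectorField.isSmooth_of_contMDiff ξ.form_isContactForm.contMDiff

/-- In charts, `λ = e^t α`. -/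
lemma liouville_pull (p : ξ.Symplectization) {z : ℝ × E}
    (hz : z ∈ (extChartAt (symplModel E) p).target) :
    ξ.liouville.pull (extChartAt (symplModel E) p).symm z =
      Real.exp z.1 • (ξ.form.pull (extChartAt 𝓘(ℝ, E) p.proj).symm z.2).comp
        (ContinuousLinearMap.snd ℝ ℝ E) := by
  have hz2 : z.2 ∈ (extChartAt 𝓘(ℝ, E) p.proj).target := by
    rw [extChartAt_target_eq] at hz
    exact hz.2
  have h1 : mfderiv 𝓘(ℝ, ℝ × E) 𝓘(ℝ, E)
      (fun z => ((extChartAt (symplModel E) p).symm z).proj) z =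
      (mfderiv (symplModel E) 𝓘(ℝ, E) (proj (ξ := ξ)) ((extChartAt (symplModel E) p).symm z)).comp
        (mfderiv 𝓘(ℝ, ℝ × E) (symplModel E) (extChartAt (symplModel E) p).symm z) :=
    mfderiv_comp z ((Symplectization.contMDiff_proj _).mdifferentiableAt (by simp))
      (mdifferentiableAt_extChartAt_symm p hz)
  have h2 : mfderiv 𝓘(ℝ, ℝ × E) 𝓘(ℝ, E) (fun z : ℝ × E => (extChartAt 𝓘(ℝ, E) p.proj).symm z.2) z =
      (mfderiv 𝓘(ℝ, E) 𝓘(ℝ, E) (extChartAt 𝓘(ℝ, E) p.proj).symm z.2).comp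
        (mfderiv 𝓘(ℝ, ℝ × E) 𝓘(ℝ, E) (Prod.snd : ℝ × E → E) z) :=
    mfderiv_comp z (mdifferentiableAt_extChartAt_symm p.proj hz2)
      (differentiableAt_snd.mdifferentiableAt)
  have h3 : mfderiv 𝓘(ℝ, ℝ × E) 𝓘(ℝ, E) (Prod.snd : ℝ × E → E) z =
      ContinuousLinearMap.snd ℝ ℝ E := by
    rw [mfderiv_eq_fderiv]
    exact fderiv_snd
  have h4 := h1.symm.trans (h2.trans (by rw [h3]))
  refine ContinuousLinearMap.ext fun v => ?_
  have h5 := congrArg (fun L => L v) h4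
  change Real.exp z.1 * ξ.form ((extChartAt 𝓘(ℝ, E) p.proj).symm z.2)
    (((mfderiv (symplModel E) 𝓘(ℝ, E) (proj (ξ := ξ)) ((extChartAt (symplModel E) p).symm z)).comp
        (mfderiv 𝓘(ℝ, ℝ × E) (symplModel E) (extChartAt (symplModel E) p).symm z)) v) = _
  exact congrArg (fun u => Real.exp z.1 * ξ.form ((extChartAt 𝓘(ℝ, E) p.proj).symm z.2) u) h5

lemma liouville_isSmooth : ξ.liouville.IsSmooth := by
  intro p
  refine ContDiffOn.congr ?_ fun z hz => liouville_pull p hz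
  have h : ContDiffOn ℝ ∞ (fun z : ℝ × E => ξ.form.pull (extChartAt 𝓘(ℝ, E) p.proj).symm z.2)
      (extChartAt (symplModel E) p).target := by
    refine (form_isSmooth p.proj).comp contDiffOn_snd fun z hz => ?_
    rw [extChartAt_target_eq] at hz
    exact hz.2
  exact (Real.contDiff_exp.comp contDiff_fst).contDiffOn.smul (h.clm_comp contDiffOn_const)

/-- At the center of the chart, tangent vectors of `Sξ` are pairs in `ℝ × E`. -/
lemma liouville_apply (p : ξ.Symplectization) (v : ℝ × E) :
    ξ.liouville p v = Real.exp (coord ξ p).1 * ξ.form p.proj v.2 := by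
  have h1 := CovectorField.pull_extChartAt_symm_self (I := symplModel E) ξ.liouville p v
  rw [liouville_pull p (mem_extChartAt_target p)] at h1
  have h2 := CovectorField.pull_extChartAt_symm_self (I := 𝓘(ℝ, E)) ξ.form p.proj v.2
  rw [← h1, ← h2]
  rfl

/-- In the coordinates `(t, x)`, `ω = d(e^t α) = e^t (dt ∧ α + dα)`. -/
lemma omega_apply (p : ξ.Symplectization) (v w : ℝ × E) :
    ξ.omega p v w = Real.exp (coord ξ p).1 *
      (v.1 * ξ.form p.proj w.2 - w.1 * ξ.form p.proj v.2 + ξ.form.d p.proj v.2 w.2) := by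
  set a := ξ.form.pull (extChartAt 𝓘(ℝ, E) p.proj).symm with ha
  set y := extChartAt 𝓘(ℝ, E) p.proj p.proj with hy
  have had : DifferentiableAt ℝ a y :=
    (form_isSmooth.contDiffAt p.proj (mem_extChartAt_target p.proj)).differentiableAt (by simp)
  set b : ℝ × E → (ℝ × E →L[ℝ] ℝ) := fun z =>
    Real.exp z.1 • (a z.2).comp (ContinuousLinearMap.snd ℝ ℝ E) with hb
  set z₀ : ℝ × E := ((coord ξ p).1, y) with hz₀
  have hcongr : ξ.liouville.pull (extChartAt (symplModel E) p).symm =ᶠ[𝓝 z₀] b := by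
    have hm : z₀ ∈ (extChartAt (symplModel E) p).target :=
      mem_extChartAt_target (I := symplModel E) p
    filter_upwards [(isOpen_extChartAt_target p).mem_nhds hm] with z hz
    exact liouville_pull p hz
  have hbd : DifferentiableAt ℝ b z₀ :=
    ((liouville_isSmooth.contDiffAt p (mem_extChartAt_target p)).differentiableAt
      (by simp)).congr_of_eventuallyEq hcongr.symm
  have hder : ∀ u w : ℝ × E, fderiv ℝ b z₀ u w =
      Real.exp (coord ξ p).1 * (u.1 * a y w.2 + fderiv ℝ a y u.2 w.2) := by
    intro u w
    have h1 : fderiv ℝ (fun z => b z w) z₀ u = fderiv ℝ b z₀ u w := by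
      rw [fderiv_clm_apply hbd (differentiableAt_const w)]
      simp
    have h2 : HasFDerivAt (fun z : ℝ × E => Real.exp z.1)
        (Real.exp z₀.1 • ContinuousLinearMap.fst ℝ ℝ E) z₀ := hasFDerivAt_fst.exp
    have h3 : HasFDerivAt (fun z : ℝ × E => a z.2)
        ((fderiv ℝ a y).comp (ContinuousLinearMap.snd ℝ ℝ E)) z₀ :=
      HasFDerivAt.comp z₀ (g := a) had.hasFDerivAt hasFDerivAt_snd
    have h4 := h2.fun_mul (h3.clm_apply (hasFDerivAt_const w.2 z₀))
    rw [← h1, show (fun z => b z w) = fun z => Real.exp z.1 * a z.2 w.2 from rfl, h4.fderiv]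
    simp [hz₀]
    ring
  have h0 : ξ.omega p v w = extDerivOneForm b z₀ v w := by
    rw [← extDerivOneForm_congr hcongr]
    exact CovectorField.d_eq liouville_isSmooth p v w
  have h5 : ∀ u : E, a y u = ξ.form p.proj u :=
    CovectorField.pull_extChartAt_symm_self (I := 𝓘(ℝ, E)) ξ.form p.proj
  have h6 : ξ.form.d p.proj v.2 w.2 = extDerivOneForm a y v.2 w.2 :=
    CovectorField.d_eq form_isSmooth p.proj v.2 w.2
  rw [h0, h6, extDerivOneForm_apply, extDerivOneForm_apply, hder, hder, h5, h5]
  ring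

/-- The Liouville vector field is `ω`-dual to `λ`. -/
lemma omega_liouvilleField (p : ξ.Symplectization) (w : TangentSpace (symplModel E) p) :
    ξ.omega p (liouvilleField p) w = ξ.liouville p w := by
  suffices key : ∀ w : ℝ × E, ξ.omega p ((1 : ℝ), (0 : E)) w = ξ.liouville p w from key w
  intro w
  have h0 : ξ.form.d p.proj (0 : E) ((w : ℝ × E).2) = 0 := by
    refine (CovectorField.d_eq form_isSmooth p.proj _ _).trans ?_
    rw [extDerivOneForm_apply]
    simp
  refine (omega_apply p ((1 : ℝ), (0 : E)) w).trans ?_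
  rw [liouville_apply, h0]
  have h1 : ξ.form p.proj (0 : E) = 0 := map_zero (ξ.form p.proj)
  rw [h1]
  ring

/-- Nondegeneracy of `ω`: pairing `v` with the Liouville direction gives `α(v) = 0`, the contact
condition makes the component of `v` along `M` vanish, and `α ≠ 0` the remaining one. -/
lemma omega_nondegenerate (p : ξ.Symplectization) (v : ℝ × E)
    (h : ∀ w : ℝ × E, ξ.omega p v w = 0) : v = 0 := by
  have he := Real.exp_pos (coord ξ p).1
  have h' : ∀ w : ℝ × E,
      v.1 * ξ.form p.proj w.2 - w.1 * ξ.form p.proj v.2 + ξ.form.d p.proj v.2 w.2 = 0 := fun w => by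
    have := h w
    rw [omega_apply] at this
    exact (mul_eq_zero.1 this).resolve_left he.ne'
  have hd0 : ∀ u : E, ξ.form.d p.proj u (0 : E) = 0 := fun u => by
    refine (CovectorField.d_eq form_isSmooth p.proj _ _).trans ?_
    rw [extDerivOneForm_apply]
    simp
  have h0 : ξ.form p.proj (0 : E) = 0 := map_zero (ξ.form p.proj)
  have h1 : ξ.form p.proj v.2 = 0 := by
    have := h' (1, 0)
    simp only [h0, hd0] at this
    linarith
  have h2 : v.2 = 0 := by
    refine ξ.form_isContactForm.nondegenerate p.proj v.2 h1 fun w hw => ?_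
    have := h' (0, w)
    simp only [hw] at this
    linarith
  have h3 : v.1 = 0 := by
    by_contra hv
    apply ξ.form_isContactForm.ne_zero p.proj
    refine ContinuousLinearMap.ext fun (u : E) => ?_
    have := h' (0, u)
    have hz : ξ.form.d p.proj v.2 u = 0 := by
      rw [h2]
      refine (CovectorField.d_eq form_isSmooth p.proj _ _).trans ?_
      rw [extDerivOneForm_apply]
      simp
    rw [hz] at this
    have h4 : v.1 * ξ.form p.proj u = 0 := by linarith
    exact (mul_eq_zero.1 h4).resolve_left hv
  exact Prod.ext h3 h2

/-- The symplectic form `ω` read in the chart around `p`. -/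
def omegaInChart (p : ξ.Symplectization) (z : ℝ × E) : ℝ × E →L[ℝ] ℝ × E →L[ℝ] ℝ :=
  extDerivOneForm (ξ.liouville.pull (extChartAt (symplModel E) p).symm) z

lemma omegaInChart_apply (p : ξ.Symplectization) {z : ℝ × E}
    (hz : z ∈ (extChartAt (symplModel E) p).target) (v w : ℝ × E) :
    omegaInChart p z v w = ξ.omega ((extChartAt (symplModel E) p).symm z)
      (mfderiv 𝓘(ℝ, ℝ × E) (symplModel E) (extChartAt (symplModel E) p).symm z v)
      (mfderiv 𝓘(ℝ, ℝ × E) (symplModel E) (extChartAt (symplModel E) p).symm z w) :=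
  CovectorField.extDerivOneForm_pull liouville_isSmooth (isOpen_extChartAt_target p)
    (contMDiffOn_extChartAt_symm p) hz v w

lemma omegaInChart_self (p : ξ.Symplectization) (v w : ℝ × E) :
    omegaInChart p (extChartAt (symplModel E) p p) v w = ξ.omega p v w :=
  (CovectorField.d_eq liouville_isSmooth p v w).symm

/-! ### Hamiltonian vector fields -/

section FiniteDimensional

variable [FiniteDimensional ℝ E]

lemma omegaInChart_isInvertible (p : ξ.Symplectization) {z : ℝ × E}
    (hz : z ∈ (extChartAt (symplModel E) p).target) : (omegaInChart p z).IsInvertible := by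
  have hinj : Function.Injective (omegaInChart p z) := by
    rw [injective_iff_map_eq_zero]
    intro v hv
    have h1 : mfderiv 𝓘(ℝ, ℝ × E) (symplModel E) (extChartAt (symplModel E) p).symm z v = 0 := by
      refine omega_nondegenerate ((extChartAt (symplModel E) p).symm z) _ fun w => ?_
      have h2 := omegaInChart_apply p hz v
        (mfderiv (symplModel E) 𝓘(ℝ, ℝ × E) (extChartAt (symplModel E) p)
          ((extChartAt (symplModel E) p).symm z) w)
      have h3 := mfderiv_extChartAt_symm_apply_mfderiv (I := symplModel E) p hz w
      refine (congrArg (fun u : ℝ × E => ξ.omega ((extChartAt (symplModel E) p).symm z)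
        (mfderiv 𝓘(ℝ, ℝ × E) (symplModel E) (extChartAt (symplModel E) p).symm z v) u)
        h3).symm.trans (h2.symm.trans ?_)
      rw [hv]
      rfl
    have h3 := mfderiv_extChartAt_apply_mfderiv_symm (I := symplModel E) p hz v
    rw [h1] at h3
    exact h3.symm.trans (map_zero _)
  have hfin : Module.finrank ℝ (ℝ × E) = Module.finrank ℝ (ℝ × E →L[ℝ] ℝ) := by
    rw [← (LinearMap.toContinuousLinearMap (𝕜 := ℝ) (E := ℝ × E) (F' := ℝ)).finrank_eq]
    exact (Subspace.dual_finrank_eq (K := ℝ) (V := ℝ × E)).symm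
  let L := LinearEquiv.ofInjectiveOfFinrankEq (omegaInChart p z : ℝ × E →ₗ[ℝ] _) hinj hfin
  exact ⟨L.toContinuousLinearEquiv, ContinuousLinearMap.ext fun _ => rfl⟩

/-- The Hamiltonian vector field of `K`, characterized by `ω(X, ·) = dK`. -/
def hamiltonianField (K : ξ.Symplectization → ℝ) (p : ξ.Symplectization) :
    TangentSpace (symplModel E) p :=
  (omegaInChart p (extChartAt (symplModel E) p p)).inverse (mfderiv (symplModel E) 𝓘(ℝ, ℝ) K p)

lemma omega_hamiltonianField (K : ξ.Symplectization → ℝ) (p : ξ.Symplectization)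
    (w : TangentSpace (symplModel E) p) :
    ξ.omega p (hamiltonianField K p) w = mfderiv (symplModel E) 𝓘(ℝ, ℝ) K p w := by
  obtain ⟨e, he⟩ := omegaInChart_isInvertible p (mem_extChartAt_target p)
  refine (omegaInChart_self p _ w).symm.trans ?_
  rw [hamiltonianField, ← he, ContinuousLinearMap.inverse_equiv]
  exact congrArg (fun L => L w) (e.apply_symm_apply (mfderiv (symplModel E) 𝓘(ℝ, ℝ) K p))

/-- The vector field `X` with `ω(X, ·) = dK` is unique. -/
lemma eq_hamiltonianField {K : ξ.Symplectization → ℝ} {p : ξ.Symplectization}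
    {v : TangentSpace (symplModel E) p}
    (h : ∀ w, ξ.omega p v w = mfderiv (symplModel E) 𝓘(ℝ, ℝ) K p w) :
    v = hamiltonianField K p := by
  obtain ⟨e, he⟩ := omegaInChart_isInvertible p (mem_extChartAt_target p)
  have h1 : omegaInChart p (extChartAt (symplModel E) p p) v =
      mfderiv (symplModel E) 𝓘(ℝ, ℝ) K p := by
    exact ContinuousLinearMap.ext fun w => (omegaInChart_self p _ w).trans (h w)
  rw [hamiltonianField, ← h1, ← he, ContinuousLinearMap.inverse_equiv]
  exact (e.symm_apply_apply _).symm

end FiniteDimensional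

end ContactStructure

lemma ContDiffOn.inverse_clm_apply {P W W' : Type*} [NormedAddCommGroup P] [NormedSpace ℝ P]
    [NormedAddCommGroup W] [NormedSpace ℝ W] [CompleteSpace W]
    [NormedAddCommGroup W'] [NormedSpace ℝ W']
    {n : WithTop ℕ∞} {A : P → W →L[ℝ] W'} {b : P → W'} {s : Set P} (hA : ContDiffOn ℝ n A s)
    (hinv : ∀ z ∈ s, (A z).IsInvertible) (hb : ContDiffOn ℝ n b s) :
    ContDiffOn ℝ n (fun z => (A z).inverse (b z)) s := by
  refine ContDiffOn.clm_apply (fun z hz => ?_) hb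
  obtain ⟨e, he⟩ := hinv z hz
  have h : ContDiffAt ℝ n ContinuousLinearMap.inverse (A z) := by
    rw [← he]
    exact contDiffAt_map_inverse e
  exact h.comp_contDiffWithinAt z (hA z hz)

namespace ContactStructure

variable {E M : Type*} [NormedAddCommGroup E] [NormedSpace ℝ E]
  [TopologicalSpace M] [ChartedSpace E M] [IsManifold 𝓘(ℝ, E) ∞ M] {ξ : ContactStructure E M}

namespace Symplectization

instance [T2Space M] : T2Space ξ.Symplectization := (coord ξ).isEmbedding.t2Space

instance [SecondCountableTopology M] : SecondCountableTopology ξ.Symplectization :=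
  (coord ξ).isEmbedding.secondCountableTopology

instance [FiniteDimensional ℝ E] : LocallyCompactSpace ξ.Symplectization :=
  Manifold.locallyCompact_of_finiteDimensional (symplModel E)

end Symplectization

open Symplectization

/-- `τ_s^* λ = e^s λ`. -/
lemma liouville_translate (s : ℝ) (p : ξ.Symplectization) (v : TangentSpace (symplModel E) p) :
    ξ.liouville (p.translate s)
        (mfderiv (symplModel E) (symplModel E) (Symplectization.translate s) p v) =
      Real.exp s * ξ.liouville p v := by
  have h1 : mfderiv (symplModel E) 𝓘(ℝ, E) (fun q : ξ.Symplectization => (q.translate s).proj) p =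
      (mfderiv (symplModel E) 𝓘(ℝ, E) (proj (ξ := ξ)) (p.translate s)).comp
        (mfderiv (symplModel E) (symplModel E) (Symplectization.translate s) p) :=
    mfderiv_comp p ((Symplectization.contMDiff_proj _).mdifferentiableAt (by simp))
      ((contMDiff_translate s _).mdifferentiableAt (by simp))
  change Real.exp s * p.covector (((mfderiv (symplModel E) 𝓘(ℝ, E) (proj (ξ := ξ))
    (p.translate s)).comp
      (mfderiv (symplModel E) (symplModel E) (Symplectization.translate s) p)) v) = _
  exact congrArg (fun L => Real.exp s * p.covector (L v)) h1.symm

/-- `τ_s^* ω = e^s ω`. -/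
lemma omega_translate (s : ℝ) (p : ξ.Symplectization) (v w : TangentSpace (symplModel E) p) :
    ξ.omega (p.translate s)
        (mfderiv (symplModel E) (symplModel E) (Symplectization.translate s) p v)
        (mfderiv (symplModel E) (symplModel E) (Symplectization.translate s) p w) =
      Real.exp s * ξ.omega p v w := by
  have h : ξ.liouville.pullback (Symplectization.translate s) =
      fun q => Real.exp s • ξ.liouville q :=
    funext fun q => ContinuousLinearMap.ext fun v => liouville_translate s q v
  refine (CovectorField.d_pullback liouville_isSmooth (contMDiff_translate s) p v w).symm.trans ?_
  rw [h]
  exact CovectorField.d_const_smul liouville_isSmooth _ p v w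

lemma hamiltonianField_congr [FiniteDimensional ℝ E] {K K' : ξ.Symplectization → ℝ}
    {p : ξ.Symplectization} (h : K =ᶠ[𝓝 p] K') : hamiltonianField K p = hamiltonianField K' p := by
  rw [hamiltonianField, hamiltonianField, h.mfderiv_eq]

lemma hamiltonianField_eq_zero [FiniteDimensional ℝ E] {K : ξ.Symplectization → ℝ}
    {p : ξ.Symplectization} (h : K =ᶠ[𝓝 p] fun _ => 0) : hamiltonianField K p = 0 := by
  rw [hamiltonianField_congr h, hamiltonianField, mfderiv_const]
  exact map_zero _

lemma omegaInChart_contDiffOn [FiniteDimensional ℝ E] (p : ξ.Symplectization) :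
    ContDiffOn ℝ ∞ (omegaInChart p) (extChartAt (symplModel E) p).target :=
  ContDiffOn.extDerivOneForm (isOpen_extChartAt_target p) (liouville_isSmooth p)

/-- In a chart, the Hamiltonian vector field is `ω⁻¹ dK`; hence it is as smooth as `ω` and `dK`. -/
lemma vectorFieldInChart_hamiltonianField [FiniteDimensional ℝ E] {K : ξ.Symplectization → ℝ}
    (hK : ContMDiff (symplModel E) 𝓘(ℝ, ℝ) ∞ K) (x : ξ.Symplectization) {y : ℝ × E}
    (hy : y ∈ (extChartAt (symplModel E) x).target) :
    vectorFieldInChart (hamiltonianField K) x y =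
      (omegaInChart x y).inverse
        (fderiv ℝ (fun z => K ((extChartAt (symplModel E) x).symm z)) y) := by
  obtain ⟨e, he⟩ := omegaInChart_isInvertible x hy
  have h1 : omegaInChart x y (vectorFieldInChart (hamiltonianField K) x y) =
      fderiv ℝ (fun z => K ((extChartAt (symplModel E) x).symm z)) y := by
    refine ContinuousLinearMap.ext fun w => ?_
    refine (omegaInChart_apply x hy _ w).trans ?_
    have h2 := mfderiv_extChartAt_symm_apply_mfderiv (I := symplModel E) x hy
      (hamiltonianField K ((extChartAt (symplModel E) x).symm y))
    refine (congrArg (fun u => ξ.omega ((extChartAt (symplModel E) x).symm y) u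
      (mfderiv 𝓘(ℝ, ℝ × E) (symplModel E) (extChartAt (symplModel E) x).symm y w)) h2).trans ?_
    rw [omega_hamiltonianField]
    have h3 : mfderiv 𝓘(ℝ, ℝ × E) 𝓘(ℝ, ℝ) (fun z => K ((extChartAt (symplModel E) x).symm z)) y =
        (mfderiv (symplModel E) 𝓘(ℝ, ℝ) K ((extChartAt (symplModel E) x).symm y)).comp
          (mfderiv 𝓘(ℝ, ℝ × E) (symplModel E) (extChartAt (symplModel E) x).symm y) :=
      mfderiv_comp y ((hK _).mdifferentiableAt (by simp)) (mdifferentiableAt_extChartAt_symm x hy)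
    rw [mfderiv_eq_fderiv] at h3
    exact congrArg (fun L => L w) h3.symm
  rw [← h1, ← he, ContinuousLinearMap.inverse_equiv]
  exact (e.symm_apply_apply _).symm

/-- The suspension of the Hamiltonian vector field of a smooth time-dependent Hamiltonian is
smooth. -/
lemma contMDiff_suspension_hamiltonianField [FiniteDimensional ℝ E]
    {K : ℝ → ξ.Symplectization → ℝ}
    (hK : ContMDiff (𝓘(ℝ, ℝ).prod (symplModel E)) 𝓘(ℝ, ℝ) ∞
      (fun q : ℝ × ξ.Symplectization => K q.1 q.2)) :
    ContMDiff (𝓘(ℝ, ℝ).prod (symplModel E)) (𝓘(ℝ, ℝ).prod (symplModel E)).tangent ∞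
      (fun q : ℝ × ξ.Symplectization =>
        (⟨q, suspension (fun t => hamiltonianField (K t)) q⟩ :
          TangentBundle (𝓘(ℝ, ℝ).prod (symplModel E)) (ℝ × ξ.Symplectization))) := by
  refine contMDiff_suspension fun x => ?_
  have hKt : ∀ t, ContMDiff (symplModel E) 𝓘(ℝ, ℝ) ∞ (K t) := fun t =>
    hK.comp (contMDiff_const.prodMk contMDiff_id)
  set T := (extChartAt (symplModel E) x).target with hT
  have hTo : IsOpen T := isOpen_extChartAt_target x
  set G : ℝ × (ℝ × E) → ℝ := fun z => K z.1 ((extChartAt (symplModel E) x).symm z.2) with hG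
  have hGs : ContDiffOn ℝ ∞ G (univ ×ˢ T) := by
    rw [← contMDiffOn_iff_contDiffOn]
    refine hK.comp_contMDiffOn
      (f := fun z : ℝ × (ℝ × E) => (z.1, (extChartAt (symplModel E) x).symm z.2))
      (ContMDiffOn.prodMk contDiffOn_fst.contMDiffOn ?_)
    exact (contMDiffOn_extChartAt_symm x).comp contDiffOn_snd.contMDiffOn fun z hz => hz.2
  have hGo : IsOpen ((univ : Set ℝ) ×ˢ T) := isOpen_univ.prod hTo
  have hd : ∀ z ∈ (univ : Set ℝ) ×ˢ T,
      fderiv ℝ (fun y => K z.1 ((extChartAt (symplModel E) x).symm y)) z.2 =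
        (fderiv ℝ G z).comp (ContinuousLinearMap.inr ℝ ℝ (ℝ × E)) := by
    intro z hz
    have h1 : HasFDerivAt G (fderiv ℝ G z) z :=
      ((hGs.contDiffAt (hGo.mem_nhds hz)).differentiableAt (by simp)).hasFDerivAt
    exact (HasFDerivAt.comp z.2 (f := fun y => (z.1, y)) h1
      (hasFDerivAt_prodMk_right z.1 z.2)).fderiv
  have hm : ContDiffOn ℝ ∞ (fun z : ℝ × (ℝ × E) => omegaInChart x z.2) (univ ×ˢ T) :=
    (omegaInChart_contDiffOn x).comp contDiffOn_snd fun z hz => hz.2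
  refine (hm.inverse_clm_apply (fun z hz => omegaInChart_isInvertible x hz.2)
    ((hGs.fderiv_of_isOpen hGo (m := ∞) (by exact_mod_cast le_rfl)).clm_comp
      (contDiffOn_const (c := ContinuousLinearMap.inr ℝ ℝ (ℝ × E))))).congr fun z hz => ?_
  rw [vectorFieldInChart_hamiltonianField (hKt z.1) x hz.2, hd z hz]

end ContactStructure

/-! ### Closed 1-forms that vanish near the negative end -/

namespace ContactStructure

variable {E M : Type*} [NormedAddCommGroup E] [NormedSpace ℝ E]
  [TopologicalSpace M] [ChartedSpace E M] [IsManifold 𝓘(ℝ, E) ∞ M] {ξ : ContactStructure E M}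

open Symplectization

/-- The number `c` is the integral of `β` along the half-orbit `{τ_s q | s ≤ 0}`. This is expressed
by a primitive that vanishes for all sufficiently negative times. -/
def IsOrbitIntegral (β : CovectorField (N := ξ.Symplectization) (symplModel E))
    (q : ξ.Symplectization) (c : ℝ) : Prop :=
  ∃ h : ℝ → ℝ, (∀ s, HasDerivAt h (β.pull (fun r => q.translate r) s 1) s) ∧
    (∃ S, ∀ s ≤ S, h s = 0) ∧ h 0 = c

lemma IsOrbitIntegral.unique {β : CovectorField (N := ξ.Symplectization) (symplModel E)}
    {q : ξ.Symplectization} {c c' : ℝ} (hc : IsOrbitIntegral β q c)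
    (hc' : IsOrbitIntegral β q c') : c = c' := by
  obtain ⟨h, hd, ⟨S, hS⟩, rfl⟩ := hc
  obtain ⟨h', hd', ⟨S', hS'⟩, rfl⟩ := hc'
  have h0 : ∀ s, HasDerivAt (fun s => h s - h' s) 0 s := fun s => by
    simpa using (hd s).fun_sub (hd' s)
  have h1 := is_const_of_deriv_eq_zero (fun s => (h0 s).differentiableAt) (fun s => (h0 s).deriv) 0
    (min S S')
  simp only [hS _ (min_le_left S S'), hS' _ (min_le_right S S')] at h1
  linarith

/-- Over a small ball in `M`, a closed 1-form that vanishes near the negative end has a primitive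
given by integration along the orbits of the `ℝ`-action. -/
lemma exists_local_primitive [FiniteDimensional ℝ E]
    {β : CovectorField (N := ξ.Symplectization) (symplModel E)} (hβ : β.IsSmooth)
    (hd : ∀ p (v w : TangentSpace (symplModel E) p), β.d p v w = 0)
    {V : Set ξ.Symplectization} (hVo : IsOpen V)
    (hVt : ∀ s ≤ (0 : ℝ), ∀ p ∈ V, p.translate s ∈ V) (hVf : ∀ x : M, ∃ p ∈ V, p.proj = x)
    (hV : ∀ p ∈ V, β p = 0) (q₀ : ξ.Symplectization) :
    ∃ (W : Set (ℝ × E)) (g : ℝ × E → ℝ), IsOpen W ∧ extChartAt (symplModel E) q₀ q₀ ∈ W ∧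
      W ⊆ (extChartAt (symplModel E) q₀).target ∧ ContDiffOn ℝ ∞ g W ∧
      (∀ z ∈ W, HasFDerivAt g (β.pull (extChartAt (symplModel E) q₀).symm z) z) ∧
      ∀ q ∈ (extChartAt (symplModel E) q₀).source, extChartAt (symplModel E) q₀ q ∈ W →
        IsOrbitIntegral β q (g (extChartAt (symplModel E) q₀ q)) := by
  set e := extChartAt (symplModel E) q₀ with he
  obtain ⟨p₀, hp₀V, hp₀⟩ := hVf q₀.proj
  set y₀ := extChartAt 𝓘(ℝ, E) q₀.proj q₀.proj with hy₀
  set t₀ := (coord ξ p₀).1 with ht₀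
  have hep₀ : e p₀ = (t₀, y₀) := by
    rw [he, extChartAt_apply, hp₀]
  have hp₀s : p₀ ∈ e.source := by
    rw [he, extChartAt_source_eq, mem_preimage, hp₀]
    exact mem_extChartAt_source _
  have hVn : ∀ᶠ y in 𝓝 y₀, y ∈ (extChartAt 𝓘(ℝ, E) q₀.proj).target ∧ e.symm (t₀, y) ∈ V := by
    refine Filter.Eventually.and ((isOpen_extChartAt_target (I := 𝓘(ℝ, E)) q₀.proj).mem_nhds
      (mem_extChartAt_target (I := 𝓘(ℝ, E)) q₀.proj)) ?_
    have h1 : ContinuousAt e.symm (t₀, y₀) := by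
      rw [← hep₀]
      exact continuousAt_extChartAt_symm'' (e.map_source hp₀s)
    have h2 : ContinuousAt (fun y : E => e.symm (t₀, y)) y₀ :=
      ContinuousAt.comp (f := fun y : E => (t₀, y)) h1 (by fun_prop)
    refine h2.eventually_mem (hVo.mem_nhds ?_)
    rw [← hep₀, e.left_inv hp₀s]
    exact hp₀V
  -- The slice `{t₀} × ball y₀ r` lies in `V`, hence so does everything below it.
  obtain ⟨r, hr, hball⟩ := Metric.eventually_nhds_iff_ball.1 hVn
  set W : Set (ℝ × E) := univ ×ˢ Metric.ball y₀ r with hW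
  have hWo : IsOpen W := isOpen_univ.prod Metric.isOpen_ball
  have hWT : W ⊆ e.target := fun z hz => by
    rw [he, extChartAt_target_eq]
    exact ⟨mem_univ _, (hball z.2 hz.2).1⟩
  have hWc : Convex ℝ W := convex_univ.prod (convex_ball _ _)
  set b := β.pull e.symm with hb
  have hbs : ContDiffOn ℝ ∞ b W := (hβ q₀).mono hWT
  obtain ⟨g, hg⟩ : ∃ g, ∀ z ∈ W, HasFDerivAt g (b z) z := by
    refine hWc.exists_forall_hasFDerivAt_of_fderiv_symmetric hWo
      (hbs.differentiableOn (by simp)) fun z hz v w => ?_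
    have h1 := CovectorField.extDerivOneForm_pull hβ (isOpen_extChartAt_target q₀)
      (contMDiffOn_extChartAt_symm q₀) (hWT hz) v w
    rw [hd, extDerivOneForm_apply] at h1
    exact sub_eq_zero.1 h1
  -- For `t ≤ t₀` the form vanishes, hence `g` is constant there.
  have hneg : ∀ z ∈ W, z.1 ≤ t₀ → b z = 0 := by
    intro z hz hzt
    have h1 : e.symm z = (e.symm (t₀, z.2)).translate (z.1 - t₀) := by
      rw [translate_eq]
      change ofCoord ξ (z.1, (extChartAt 𝓘(ℝ, E) q₀.proj).symm z.2) =
        ofCoord ξ ((coord ξ (ofCoord ξ (t₀, (extChartAt 𝓘(ℝ, E) q₀.proj).symm z.2))).1 + (z.1 - t₀),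
          (extChartAt 𝓘(ℝ, E) q₀.proj).symm z.2)
      rw [coord_ofCoord]
      congr 2
      ring
    have h2 : e.symm z ∈ V := by
      rw [h1]
      exact hVt _ (by linarith) _ (hball z.2 hz.2).2
    rw [hb, CovectorField.pull, hV _ h2]
    exact ContinuousLinearMap.zero_comp _
  have hpt : (t₀, y₀) ∈ W := ⟨mem_univ _, Metric.mem_ball_self hr⟩
  have hconst : ∀ z ∈ W, z.1 ≤ t₀ → g z = g (t₀, y₀) := by
    intro z hz hzt
    have hcv : Convex ℝ (Iic t₀ ×ˢ Metric.ball y₀ r) := (convex_Iic _).prod (convex_ball _ _)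
    have hsub : Iic t₀ ×ˢ Metric.ball y₀ r ⊆ W := prod_mono (subset_univ _) le_rfl
    have h1 := hcv.norm_image_sub_le_of_norm_hasFDerivWithin_le (C := 0) (f := g) (f' := b)
      (fun w hw => (hg w (hsub hw)).hasFDerivWithinAt)
      (fun w hw => by rw [hneg w (hsub hw) hw.1, norm_zero])
      (x := (t₀, y₀)) (y := z) ⟨mem_Iic.2 le_rfl, hpt.2⟩ ⟨hzt, hz.2⟩
    rw [zero_mul] at h1
    exact sub_eq_zero.1 (norm_le_zero_iff.1 h1)
  -- Subtracting that constant, the primitive vanishes near the negative end.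
  refine ⟨W, fun z => g z - g (t₀, y₀), hWo, ⟨mem_univ _, Metric.mem_ball_self hr⟩, hWT, ?_,
    fun z hz => (hg z hz).sub_const _, fun q hq hqW => ?_⟩
  · refine ContDiffOn.sub ?_ contDiffOn_const
    rw [contDiffOn_infty_iff_fderiv_of_isOpen hWo]
    exact ⟨fun z hz => (hg z hz).differentiableAt.differentiableWithinAt,
      hbs.congr fun z hz => (hg z hz).fderiv⟩
  · set a : ℝ → ℝ × E := fun r => ((e q).1 + r, (e q).2) with ha
    have haW : ∀ s, a s ∈ W := fun s => ⟨mem_univ _, hqW.2⟩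
    have had : ∀ s, HasDerivAt a ((1 : ℝ), (0 : E)) s := fun s =>
      ((hasDerivAt_id s).const_add _).prodMk (hasDerivAt_const s _)
    have hcurve : (fun r => q.translate r) = fun r => e.symm (a r) := by
      funext r
      rw [translate_eq]
      change ofCoord ξ ((coord ξ q).1 + r, q.proj) = ofCoord ξ ((coord ξ q).1 + r,
        (extChartAt 𝓘(ℝ, E) q₀.proj).symm (extChartAt 𝓘(ℝ, E) q₀.proj q.proj))
      rw [(extChartAt 𝓘(ℝ, E) q₀.proj).left_inv]
      rw [he, extChartAt_source_eq] at hq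
      exact hq
    refine ⟨fun s => g (a s) - g (t₀, y₀), fun s => ?_, ⟨t₀ - (e q).1, fun s hs => ?_⟩, ?_⟩
    · have h1 : mfderiv 𝓘(ℝ, ℝ) (symplModel E) (fun r => e.symm (a r)) s =
          (mfderiv 𝓘(ℝ, ℝ × E) (symplModel E) e.symm (a s)).comp
            (mfderiv 𝓘(ℝ, ℝ) 𝓘(ℝ, ℝ × E) a s) :=
        mfderiv_comp s (mdifferentiableAt_extChartAt_symm q₀ (hWT (haW s)))
          (had s).differentiableAt.mdifferentiableAt
      have h2 : β.pull (fun r => q.translate r) s 1 = b (a s) ((1 : ℝ), (0 : E)) := by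
        rw [hcurve, CovectorField.pull, h1, mfderiv_eq_fderiv, (had s).hasFDerivAt.fderiv]
        change b (a s) ((1 : ℝ) • ((1 : ℝ), (0 : E))) = _
        rw [one_smul]
      rw [h2]
      exact ((hg _ (haW s)).comp_hasDerivAt s (had s)).sub_const _
    · change g (a s) - g (t₀, y₀) = 0
      rw [hconst (a s) (haW s) (by change (e q).1 + s ≤ t₀; linarith), sub_self]
    · change g ((e q).1 + 0, (e q).2) - _ = _
      rw [add_zero]

/-- A closed 1-form on the symplectization that vanishes near the negative end is exact. -/
lemma exists_primitive [FiniteDimensional ℝ E]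
    {β : CovectorField (N := ξ.Symplectization) (symplModel E)} (hβ : β.IsSmooth)
    (hd : ∀ p (v w : TangentSpace (symplModel E) p), β.d p v w = 0)
    (hneg : ∃ U, ξ.IsNhdNegativeEnd U ∧ ∀ p ∈ U, β p = 0) :
    ∃ f : ξ.Symplectization → ℝ, ContMDiff (symplModel E) 𝓘(ℝ, ℝ) ∞ f ∧
      ∀ p (v : TangentSpace (symplModel E) p), mfderiv (symplModel E) 𝓘(ℝ, ℝ) f p v = β p v := by
  obtain ⟨U, ⟨V, hVU, hVo, hVt, hVf⟩, hU⟩ := hneg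
  have hloc := exists_local_primitive hβ hd hVo hVt hVf fun p hp => hU p (hVU hp)
  have hex : ∀ q, ∃ c, IsOrbitIntegral β q c := fun q => by
    obtain ⟨W, g, -, hqW, -, -, -, h⟩ := hloc q
    exact ⟨_, h q (mem_extChartAt_source q) hqW⟩
  -- By uniqueness of the orbit integrals, the local primitives agree on overlaps.
  choose f hf using hex
  have heq : ∀ q₀, ∃ (W : Set (ℝ × E)) (g : ℝ × E → ℝ), W ∈ 𝓝 (extChartAt (symplModel E) q₀ q₀) ∧
      ContDiffOn ℝ ∞ g W ∧
      HasFDerivAt g (β.pull (extChartAt (symplModel E) q₀).symm (extChartAt (symplModel E) q₀ q₀))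
        (extChartAt (symplModel E) q₀ q₀) ∧
      f =ᶠ[𝓝 q₀] fun q => g (extChartAt (symplModel E) q₀ q) := by
    intro q₀
    obtain ⟨W, g, hWo, hqW, -, hgs, hgd, h⟩ := hloc q₀
    refine ⟨W, g, hWo.mem_nhds hqW, hgs, hgd _ hqW, ?_⟩
    filter_upwards [extChartAt_source_mem_nhds (I := symplModel E) q₀,
      (continuousAt_extChartAt (I := symplModel E) q₀).eventually_mem
        (hWo.mem_nhds hqW)] with q h1 h2
    exact (hf q).unique (h q h1 h2)
  refine ⟨f, fun q₀ => ?_, fun q₀ v => ?_⟩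
  · obtain ⟨W, g, hW, hgs, -, hfg⟩ := heq q₀
    refine ContMDiffAt.congr_of_eventuallyEq ?_ hfg
    exact (hgs.contDiffAt hW).contMDiffAt.comp q₀ contMDiffAt_extChartAt
  · obtain ⟨W, g, -, -, hgd, hfg⟩ := heq q₀
    have h1 : HasMFDerivAt (symplModel E) 𝓘(ℝ, ℝ) (fun q => g (extChartAt (symplModel E) q₀ q)) q₀
        ((β.pull (extChartAt (symplModel E) q₀).symm (extChartAt (symplModel E) q₀ q₀)).comp
          (mfderiv (symplModel E) 𝓘(ℝ, ℝ × E) (extChartAt (symplModel E) q₀) q₀)) :=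
      hgd.hasMFDerivAt.comp q₀
        (mdifferentiableAt_extChartAt (mem_chart_source _ q₀)).hasMFDerivAt
    rw [hfg.mfderiv_eq, h1.mfderiv, mfderiv_extChartAt_self]
    exact CovectorField.pull_extChartAt_symm_self (I := symplModel E) β q₀ v

end ContactStructure

/-! ### Compactly supported Hamiltonian isotopies -/

namespace ContactStructure

variable {E M : Type*} [NormedAddCommGroup E] [NormedSpace ℝ E]
  [TopologicalSpace M] [ChartedSpace E M] [IsManifold 𝓘(ℝ, E) ∞ M] {ξ : ContactStructure E M}

open Symplectization

section Flow

variable [FiniteDimensional ℝ E] [T2Space M]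

/-- The diffeomorphism `Φ_t` obtained from the flow `Θ` of `∂_t + X_t` on `ℝ × Sξ` by
`Θ_t(0, p) = (t, Φ_t(p))`. -/
def flowDiffeo {X : ℝ → ∀ p : ξ.Symplectization, TangentSpace (symplModel E) p}
    {Θ : ℝ × (ℝ × ξ.Symplectization) → ℝ × ξ.Symplectization}
    (hΘ : ContMDiff (𝓘(ℝ, ℝ).prod (𝓘(ℝ, ℝ).prod (symplModel E))) (𝓘(ℝ, ℝ).prod (symplModel E)) ∞ Θ)
    (h0 : ∀ q, Θ (0, q) = q) (hcurve : ∀ q, IsMIntegralCurve (fun t => Θ (t, q)) (suspension X))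
    (hadd : ∀ s t q, Θ (s + t, q) = Θ (s, Θ (t, q))) (t : ℝ) : ξ.SymplDiffeo where
  toFun p := (Θ (t, (0, p))).2
  invFun q := (Θ (-t, (t, q))).2
  left_inv p := by
    have h1 : (t, (Θ (t, (0, p))).2) = Θ (t, (0, p)) := by
      refine Prod.ext ?_ rfl
      change t = (Θ (t, (0, p))).1
      rw [suspension_flow_fst (hcurve (0, p)) t]
      simp only [h0, zero_add]
    change (Θ (-t, (t, (Θ (t, (0, p))).2))).2 = p
    rw [h1, ← hadd, neg_add_cancel, h0]
  right_inv q := by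
    have h1 : (0, (Θ (-t, (t, q))).2) = Θ (-t, (t, q)) := by
      refine Prod.ext ?_ rfl
      change 0 = (Θ (-t, (t, q))).1
      rw [suspension_flow_fst (hcurve (t, q)) (-t)]
      simp only [h0, add_neg_cancel]
    change (Θ (t, (0, (Θ (-t, (t, q))).2))).2 = q
    rw [h1, ← hadd, add_neg_cancel, h0]
  contMDiff_toFun := contMDiff_snd.comp (hΘ.comp
    (contMDiff_const.prodMk (contMDiff_const.prodMk contMDiff_id)))
  contMDiff_invFun := contMDiff_snd.comp (hΘ.comp
    (contMDiff_const.prodMk (contMDiff_const.prodMk contMDiff_id)))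

/-- A Hamiltonian with compact support in `ℝ × Sξ` generates a compactly supported Hamiltonian
isotopy, which follows the integral curves of the Hamiltonian vector field. -/
theorem exists_isotopy_of_compact_support {K : ℝ → ξ.Symplectization → ℝ}
    (hK : ContMDiff (𝓘(ℝ, ℝ).prod (symplModel E)) 𝓘(ℝ, ℝ) ∞
      (fun q : ℝ × ξ.Symplectization => K q.1 q.2))
    {J : Set ℝ} (hJ : IsCompact J) {C : Set ξ.Symplectization} (hC : IsCompact C)
    (hKJ : ∀ t ∉ J, ∀ p, K t p = 0) (hKC : ∀ t, ∀ p ∉ C, K t p = 0) :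
    ∃ Φ : ℝ → ξ.SymplDiffeo, IsCompactlySupportedHamiltonianIsotopy Φ ∧
      ∀ γ : ℝ → ξ.Symplectization, (∀ t ∈ Ioo (-1 : ℝ) 2, HasMFDerivAt 𝓘(ℝ, ℝ) (symplModel E) γ t
        ((1 : ℝ →L[ℝ] ℝ).smulRight (hamiltonianField (K t) (γ t)))) → Φ 1 (γ 0) = γ 1 := by
  set X : ℝ → ∀ p : ξ.Symplectization, TangentSpace (symplModel E) p :=
    fun t => hamiltonianField (K t) with hX
  have hXs := contMDiff_suspension_hamiltonianField hK
  have hX1 := hXs.of_le (show (1 : WithTop ℕ∞) ≤ ∞ by exact_mod_cast le_top)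
  have hXC' : ∀ t, ∀ p ∉ C, X t p = 0 := fun t p hp => hamiltonianField_eq_zero (by
    filter_upwards [hC.isClosed.isOpen_compl.mem_nhds hp] with q hq
    exact hKC t q hq)
  have hXC : ∀ q ∉ J ×ˢ C, X q.1 q.2 = 0 := by
    rintro ⟨t, p⟩ hq
    by_cases ht : t ∈ J
    · exact hXC' t p fun hp => hq ⟨ht, hp⟩
    · exact hamiltonianField_eq_zero (Filter.Eventually.of_forall (hKJ t ht))
  obtain ⟨Θ, hΘ, h0, hcurve⟩ := exists_flow_suspension hXs (hJ.prod hC) hXC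
  have hadd := IsMIntegralCurve.flow_add hXs h0 hcurve
  have hfst : ∀ p, (Θ (0, ((0 : ℝ), p))).1 = 0 := fun p => by rw [h0]
  refine ⟨flowDiffeo hΘ h0 hcurve hadd, ⟨?_, fun p => ?_, K, C, hK.contMDiffOn, hC, ?_, ?_⟩, ?_⟩
  · exact (contMDiff_snd.comp (hΘ.comp (contMDiff_fst.prodMk
      (contMDiff_const.prodMk contMDiff_snd)))).contMDiffOn
  · change (Θ (0, (0, p))).2 = p
    rw [h0]
  -- Points outside `C` are at rest.
  · intro t _ p hp
    refine ⟨hKC t p hp, ?_⟩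
    have hc : IsMIntegralCurve (fun s : ℝ => (s, p)) (suspension X) := fun s => by
      have h1 := hasMFDerivAt_prodMk_curve (I := symplModel E) (γ := fun _ : ℝ => p) (v := X s p)
        (hasDerivAt_id s) (by
          rw [hXC' s p hp]
          refine (hasMFDerivAt_const p s).congr_mfderiv ?_
          exact ContinuousLinearMap.ext_ring (smul_zero (1 : ℝ)).symm)
      exact h1
    have h2 := isMIntegralCurve_Ioo_eq_of_contMDiff_boundaryless (t₀ := 0) hX1 (hcurve (0, p)) hc
      (h0 _)
    exact congrArg Prod.snd (congrFun h2 t)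
  · intro t ht p w
    have h1 := (suspension_flow_snd (hcurve (0, p)) (hfst p) t).hasMFDerivWithinAt (s := Icc 0 1)
    have h2 := h1.mfderivWithin
      (uniqueMDiffWithinAt_iff_uniqueDiffWithinAt.2 (uniqueDiffOn_Icc zero_lt_one t ht))
    have h3 : mfderivWithin 𝓘(ℝ, ℝ) (symplModel E) (fun s : ℝ => (Θ (s, (0, p))).2) (Icc 0 1) t
        (1 : ℝ) = X t (Θ (t, (0, p))).2 := by
      rw [h2]
      exact one_smul ℝ _
    refine (congrArg (fun v => ξ.omega (Θ (t, (0, p))).2 v w) h3).trans ?_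
    exact omega_hamiltonianField (K t) _ w
  · intro γ hγ
    have hc : IsMIntegralCurveOn (fun s : ℝ => (s, γ s)) (suspension X) (Ioo (-1) 2) := fun s hs =>
      (hasMFDerivAt_prodMk_curve (hasDerivAt_id s) (hγ s hs)).hasMFDerivWithinAt
    have h1 := isMIntegralCurveOn_Ioo_eqOn_of_contMDiff_boundaryless (t₀ := 0) (by norm_num) hX1
      ((hcurve (0, γ 0)).isMIntegralCurveOn _) hc (h0 _)
    exact congrArg Prod.snd (h1 (by norm_num : (1 : ℝ) ∈ Ioo (-1 : ℝ) 2))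

/-- Cutting off: the integral curves that stay in a compact set are those of a compactly supported
Hamiltonian isotopy. -/
theorem exists_isotopy_of_compact [SecondCountableTopology M] {H : ℝ → ξ.Symplectization → ℝ}
    (hH : ContMDiff (𝓘(ℝ, ℝ).prod (symplModel E)) 𝓘(ℝ, ℝ) ∞
      (fun q : ℝ × ξ.Symplectization => H q.1 q.2))
    {A : Set ξ.Symplectization} (hA : IsCompact A) :
    ∃ Φ : ℝ → ξ.SymplDiffeo, IsCompactlySupportedHamiltonianIsotopy Φ ∧
      ∀ γ : ℝ → ξ.Symplectization, (∀ t ∈ Ioo (-1 : ℝ) 2, γ t ∈ A ∧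
        HasMFDerivAt 𝓘(ℝ, ℝ) (symplModel E) γ t
          ((1 : ℝ →L[ℝ] ℝ).smulRight (hamiltonianField (H t) (γ t)))) → Φ 1 (γ 0) = γ 1 := by
  obtain ⟨C, hC, hAC⟩ := exists_compact_superset hA
  obtain ⟨χ, hχA, hχC, -⟩ := exists_contMDiffMap_one_nhds_of_subset_interior (symplModel E)
    (n := ⊤) hA.isClosed hAC
  obtain ⟨ρ, hρ1, hρ0, -⟩ := exists_contMDiffMap_one_nhds_of_subset_interior 𝓘(ℝ, ℝ)
    (n := ⊤) (s := Icc (-1 : ℝ) 2) (t := Icc (-2 : ℝ) 3) isClosed_Icc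
    (by rw [interior_Icc]; exact Icc_subset_Ioo (by norm_num) (by norm_num))
  obtain ⟨Φ, hΦ, hΦγ⟩ := exists_isotopy_of_compact_support
    (K := fun t p => ρ t * (χ p * H t p)) (J := Icc (-2) 3) (C := C)
    ((ρ.contMDiff.comp contMDiff_fst).mul ((χ.contMDiff.comp contMDiff_snd).mul hH))
    isCompact_Icc hC (fun t ht p => by rw [hρ0 t ht, zero_mul])
    (fun t p hp => by rw [hχC p hp, zero_mul, mul_zero])
  refine ⟨Φ, hΦ, fun γ hγ => hΦγ γ fun t ht => ?_⟩
  have h1 : (fun p => ρ t * (χ p * H t p)) =ᶠ[𝓝 (γ t)] H t := by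
    filter_upwards [Filter.Eventually.filter_mono (nhds_le_nhdsSet (hγ t ht).1) hχA] with p hp
    rw [hp, hρ1.self_of_nhdsSet t (Ioo_subset_Icc_self ht), one_mul, one_mul]
  rw [hamiltonianField_congr h1]
  exact (hγ t ht).2

end Flow

end ContactStructure

/-! ### The conjugates of a pseudo-isotopy by the `ℝ`-action -/

namespace ContactStructure

variable {E M : Type*} [NormedAddCommGroup E] [NormedSpace ℝ E]
  [TopologicalSpace M] [ChartedSpace E M] [IsManifold 𝓘(ℝ, E) ∞ M] {ξ : ContactStructure E M}

open Symplectization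

/-- For a symplectic pseudo-isotopy `F`, the closed form `F^*λ - λ` is exact. -/
lemma IsSymplecticPseudoIsotopy.exists_primitive [FiniteDimensional ℝ E] {F : ξ.SymplDiffeo}
    (hF : IsSymplecticPseudoIsotopy F) :
    ∃ f : ξ.Symplectization → ℝ, ContMDiff (symplModel E) 𝓘(ℝ, ℝ) ∞ f ∧
      ∀ p (v : TangentSpace (symplModel E) p), mfderiv (symplModel E) 𝓘(ℝ, ℝ) f p v =
        ξ.liouville (F p) (mfderiv (symplModel E) (symplModel E) F p v) - ξ.liouville p v := by
  have hs := liouville_isSmooth (ξ := ξ)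
  have hp := hs.pullback F.contMDiff
  obtain ⟨f, hf, hdf⟩ := ContactStructure.exists_primitive (hp.sub hs) (fun p v w => by
    rw [CovectorField.d_sub hp hs, CovectorField.d_pullback hs F.contMDiff]
    exact sub_eq_zero.2 (hF.symplectic p v w)) (by
    obtain ⟨U, ⟨V, hVU, hVo, hVt, hVf⟩, hU⟩ := hF.eq_id_negative
    refine ⟨V, ⟨V, le_rfl, hVo, hVt, hVf⟩, fun p hp => sub_eq_zero.2 ?_⟩
    have h1 : (F : ξ.Symplectization → ξ.Symplectization) =ᶠ[𝓝 p] id := by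
      filter_upwards [hVo.mem_nhds hp] with q hq
      exact hU q (hVU hq)
    have h2 : ∀ q, q = p → ∀ v : ℝ × E, ξ.liouville q v = ξ.liouville p v := by
      rintro q rfl v
      rfl
    refine ContinuousLinearMap.ext fun v => ?_
    change ξ.liouville (F p) (mfderiv (symplModel E) (symplModel E) F p v) = _
    rw [h1.mfderiv_eq, mfderiv_id]
    exact h2 (F p) h1.self_of_nhds v)
  exact ⟨f, hf, hdf⟩

/-- The action of `s ∈ ℝ` as a diffeomorphism. -/
def translateDiffeo (s : ℝ) : ξ.SymplDiffeo where
  toFun := Symplectization.translate s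
  invFun := Symplectization.translate (-s)
  left_inv p := by
    rw [Symplectization.translate_translate, add_neg_cancel, Symplectization.translate_zero]
  right_inv p := by
    rw [Symplectization.translate_translate, neg_add_cancel, Symplectization.translate_zero]
  contMDiff_toFun := contMDiff_translate s
  contMDiff_invFun := contMDiff_translate (-s)

lemma omega_add_left (p : ξ.Symplectization) (v v' w : TangentSpace (symplModel E) p) :
    ξ.omega p (v + v') w = ξ.omega p v w + ξ.omega p v' w := by
  suffices h : ∀ v v' w : ℝ × E, ξ.omega p (v + v' : ℝ × E) w = ξ.omega p v w + ξ.omega p v' w from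
    h v v' w
  intro v v' w
  rw [← omegaInChart_self, ← omegaInChart_self, ← omegaInChart_self, map_add, add_apply]

lemma omega_neg_left (p : ξ.Symplectization) (v w : TangentSpace (symplModel E) p) :
    ξ.omega p (-v) w = -ξ.omega p v w := by
  suffices h : ∀ v w : ℝ × E, ξ.omega p (-v : ℝ × E) w = -ξ.omega p v w from h v w
  intro v w
  rw [← omegaInChart_self, ← omegaInChart_self, map_neg, neg_apply]

/-- The conjugates `Ψ_s = τ_{-s} ∘ F ∘ τ_s` of `F` by the `ℝ`-action. -/
def conjTranslate (F : ξ.SymplDiffeo) (s : ℝ) (p : ξ.Symplectization) : ξ.Symplectization :=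
  (F (p.translate s)).translate (-s)

/-- The Hamiltonian that generates the family `Ψ_s`, for a primitive `f` of `F^*λ - λ`. -/
def conjHamiltonian (F : ξ.SymplDiffeo) (f : ξ.Symplectization → ℝ) (s : ℝ)
    (q : ξ.Symplectization) : ℝ :=
  -Real.exp (-s) * f (F.symm (q.translate s))

lemma contMDiff_conjTranslate (F : ξ.SymplDiffeo) :
    ContMDiff (𝓘(ℝ, ℝ).prod (symplModel E)) (symplModel E) ∞
      (fun q : ℝ × ξ.Symplectization => conjTranslate F q.1 q.2) := by
  have h1 : ContMDiff (𝓘(ℝ, ℝ).prod (symplModel E)) 𝓘(ℝ, ℝ) ∞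
      (fun q : ℝ × ξ.Symplectization => -q.1) := contDiff_neg.contMDiff.comp contMDiff_fst
  exact contMDiff_translate_uncurry.comp
    (h1.prodMk (F.contMDiff.comp contMDiff_translate_uncurry))

lemma contMDiff_conjHamiltonian (F : ξ.SymplDiffeo) {f : ξ.Symplectization → ℝ}
    (hf : ContMDiff (symplModel E) 𝓘(ℝ, ℝ) ∞ f) :
    ContMDiff (𝓘(ℝ, ℝ).prod (symplModel E)) 𝓘(ℝ, ℝ) ∞
      (fun q : ℝ × ξ.Symplectization => conjHamiltonian F f q.1 q.2) := by
  have h1 : ContMDiff (𝓘(ℝ, ℝ).prod (symplModel E)) 𝓘(ℝ, ℝ) ∞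
      (fun q : ℝ × ξ.Symplectization => -Real.exp (-q.1)) :=
    (Real.contDiff_exp.comp contDiff_neg).neg.contMDiff.comp contMDiff_fst
  exact h1.mul (hf.comp (F.symm.contMDiff.comp contMDiff_translate_uncurry))

/-- The velocity of `s ↦ Ψ_s(p)`. -/
lemma mfderiv_conjTranslate (F : ξ.SymplDiffeo) (s : ℝ) (p : ξ.Symplectization) :
    mfderiv 𝓘(ℝ, ℝ) (symplModel E) (fun s => conjTranslate F s p) s (1 : ℝ) =
      -liouvilleField ((F (p.translate s)).translate (-s)) +
        mfderiv (symplModel E) (symplModel E) (Symplectization.translate (-s)) (F (p.translate s))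
          (mfderiv (symplModel E) (symplModel E) F (p.translate s)
            (liouvilleField (p.translate s))) := by
  set y : ℝ → ξ.Symplectization := fun s => F (p.translate s) with hy
  have h1 : HasMFDerivAt 𝓘(ℝ, ℝ) (symplModel E) y s
      ((mfderiv (symplModel E) (symplModel E) F (p.translate s)).comp
        ((1 : ℝ →L[ℝ] ℝ).smulRight (liouvilleField (p.translate s)))) :=
    HasMFDerivAt.comp s ((F.contMDiff _).mdifferentiableAt (by simp)).hasMFDerivAt
      (hasMFDerivAt_translate p s)
  have h2 : HasMFDerivAt 𝓘(ℝ, ℝ) (𝓘(ℝ, ℝ).prod (symplModel E)) (fun s => (-s, y s)) s _ :=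
    (hasDerivAt_neg s).hasFDerivAt.hasMFDerivAt.prodMk h1
  have hm : MDifferentiableAt (𝓘(ℝ, ℝ).prod (symplModel E)) (symplModel E)
      (fun q : ℝ × ξ.Symplectization => q.2.translate q.1) (-s, y s) :=
    (contMDiff_translate_uncurry _).mdifferentiableAt (by simp)
  have h3 := HasMFDerivAt.comp s hm.hasMFDerivAt h2
  have h4 := congrArg (fun L => L (1 : ℝ)) h3.mfderiv
  refine h4.trans ((mfderiv_prod_eq_add_apply hm).trans ?_)
  have h5 : ∀ c : ℝ, mfderiv 𝓘(ℝ, ℝ) (symplModel E) (fun r => (y s).translate r) (-s) c =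
      c • liouvilleField ((y s).translate (-s)) := fun c =>
    congrArg (fun L => L c) (hasMFDerivAt_translate (y s) (-s)).mfderiv
  refine congrArg₂ (fun a b : ℝ × E => a + b) ((h5 ((1 : ℝ) • (-1))).trans ?_) ?_
  · rw [one_smul]
    exact neg_one_smul ℝ _
  refine congrArg (fun v => mfderiv (symplModel E) (symplModel E)
    (Symplectization.translate (-s)) (F (p.translate s))
    (mfderiv (symplModel E) (symplModel E) F (p.translate s) v)) ?_
  exact one_smul ℝ _

/-- The family `Ψ_s` is generated by the Hamiltonian `-e^{-s} f ∘ F⁻¹ ∘ τ_s`. With `r = τ_s(p)` and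
`w = dτ_{-s} dF u`, the velocity `-Z + dτ_{-s} dF Z` pairs with `w` to
`-e^{-s} λ(dF u) + e^{-s} λ(u) = -e^{-s} df(u)`, because `τ_{-s}` scales `λ` and `ω` by `e^{-s}`,
`F` preserves `ω`, and `ω(Z, ·) = λ`. -/
lemma hasMFDerivAt_conjTranslate [FiniteDimensional ℝ E] {F : ξ.SymplDiffeo}
    (hF : IsSymplectomorphism F) {f : ξ.Symplectization → ℝ}
    (hf : ContMDiff (symplModel E) 𝓘(ℝ, ℝ) ∞ f)
    (hdf : ∀ p (v : TangentSpace (symplModel E) p), mfderiv (symplModel E) 𝓘(ℝ, ℝ) f p v =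
      ξ.liouville (F p) (mfderiv (symplModel E) (symplModel E) F p v) - ξ.liouville p v)
    (p : ξ.Symplectization) (s : ℝ) :
    HasMFDerivAt 𝓘(ℝ, ℝ) (symplModel E) (fun s => conjTranslate F s p) s
      ((1 : ℝ →L[ℝ] ℝ).smulRight
        (hamiltonianField (conjHamiltonian F f s) (conjTranslate F s p))) := by
  have hc : ContMDiff 𝓘(ℝ, ℝ) (symplModel E) ∞ (fun s => conjTranslate F s p) :=
    (contMDiff_conjTranslate F).comp (contMDiff_id.prodMk contMDiff_const)
  have hH : ContMDiff (symplModel E) 𝓘(ℝ, ℝ) ∞ (conjHamiltonian F f s) :=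
    (contMDiff_conjHamiltonian F hf).comp (contMDiff_const.prodMk contMDiff_id)
  refine ((hc s).mdifferentiableAt (by simp)).hasMFDerivAt.congr_mfderiv ?_
  refine ContinuousLinearMap.ext_ring ?_
  refine Eq.trans ?_ (one_smul ℝ _).symm
  let r := p.translate s
  refine (mfderiv_conjTranslate F s p).trans (eq_hamiltonianField fun w => ?_)
  let L : ξ.SymplDiffeo := F.trans (translateDiffeo (-s))
  have hL : mfderiv (symplModel E) (symplModel E) L r =
      (mfderiv (symplModel E) (symplModel E) (Symplectization.translate (-s)) (F r)).comp
        (mfderiv (symplModel E) (symplModel E) F r) :=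
    mfderiv_comp r ((contMDiff_translate _ _).mdifferentiableAt (by simp))
      ((F.contMDiff _).mdifferentiableAt (by simp))
  obtain ⟨u, hu⟩ : ∃ u : TangentSpace (symplModel E) r,
      mfderiv (symplModel E) (symplModel E) (Symplectization.translate (-s)) (F r)
        (mfderiv (symplModel E) (symplModel E) F r u) = w := by
    let e := L.mfderivToContinuousLinearEquiv (by simp) r
    refine ⟨e.symm w, ?_⟩
    have h1 : mfderiv (symplModel E) (symplModel E) L r (e.symm w) = w := e.apply_symm_apply w
    rw [hL] at h1
    exact h1
  have hHL : (fun x => conjHamiltonian F f s (L x)) = fun x => -Real.exp (-s) • f x := by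
    funext x
    change -Real.exp (-s) * f (F.symm (((F x).translate (-s)).translate s)) = _
    rw [Symplectization.translate_translate, neg_add_cancel,
      Symplectization.translate_zero, F.symm_apply_apply]
    rfl
  have hdH : mfderiv (symplModel E) 𝓘(ℝ, ℝ) (fun x => conjHamiltonian F f s (L x)) r =
      (mfderiv (symplModel E) 𝓘(ℝ, ℝ) (conjHamiltonian F f s) (L r)).comp
        (mfderiv (symplModel E) (symplModel E) L r) :=
    mfderiv_comp r ((hH _).mdifferentiableAt (by simp))
      ((L.contMDiff _).mdifferentiableAt (by simp))
  have hd2 : mfderiv (symplModel E) 𝓘(ℝ, ℝ) (fun x => -Real.exp (-s) • f x) r =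
      -Real.exp (-s) • mfderiv (symplModel E) 𝓘(ℝ, ℝ) f r :=
    const_smul_mfderiv ((hf r).mdifferentiableAt (by simp)) _
  have hR : mfderiv (symplModel E) 𝓘(ℝ, ℝ) (conjHamiltonian F f s) (conjTranslate F s p)
      (mfderiv (symplModel E) (symplModel E) (Symplectization.translate (-s)) (F r)
        (mfderiv (symplModel E) (symplModel E) F r u)) =
      -Real.exp (-s) * (ξ.liouville (F r) (mfderiv (symplModel E) (symplModel E) F r u) -
        ξ.liouville r u) := by
    rw [← hdf]
    rw [hHL, hd2, hL] at hdH
    exact (congrArg (fun L => L u) hdH).symm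
  have h1 := liouville_translate (-s) (F r) (mfderiv (symplModel E) (symplModel E) F r u)
  have h2 := (omega_translate (-s) (F r)
    (mfderiv (symplModel E) (symplModel E) F r (liouvilleField r))
    (mfderiv (symplModel E) (symplModel E) F r u)).trans
      (congrArg (fun a => Real.exp (-s) * a) ((hF r _ u).trans (omega_liouvilleField r u)))
  refine (congrArg (fun w => ξ.omega ((F r).translate (-s)) _ w) hu).symm.trans (Eq.trans ?_
    (congrArg (fun w => mfderiv (symplModel E) 𝓘(ℝ, ℝ) (conjHamiltonian F f s)
      (conjTranslate F s p) w) hu))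
  refine ((omega_add_left _ _ _ _).trans (congrArg₂ (fun a b : ℝ => a + b)
    ((omega_neg_left _ _ _).trans (congrArg Neg.neg ((omega_liouvilleField _ _).trans h1)))
    h2)).trans ?_
  refine Eq.trans ?_ hR.symm
  ring

/-- A compact set is moved into a given neighborhood of an end by all sufficiently large
translations; `ε = 1` for the positive end and `ε = -1` for the negative end. -/
lemma exists_translate_mem {ε : ℝ} (hε : ε * ε = 1) {V : Set ξ.Symplectization} (hVo : IsOpen V)
    (hVt : ∀ s ≥ (0 : ℝ), ∀ p ∈ V, p.translate (ε * s) ∈ V) (hVf : ∀ x : M, ∃ p ∈ V, p.proj = x)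
    {K : Set ξ.Symplectization} (hK : IsCompact K) :
    ∃ S₀ : ℝ, ∀ S ≥ S₀, ∀ p ∈ K, p.translate (ε * S) ∈ V := by
  have hmono : ∀ (a b : ℝ) (p : ξ.Symplectization), a ≤ b → p.translate (ε * a) ∈ V →
      p.translate (ε * b) ∈ V := by
    intro a b p hab hp
    have := hVt (b - a) (sub_nonneg.2 hab) _ hp
    rwa [Symplectization.translate_translate, ← mul_add, add_sub_cancel] at this
  let U : ℕ → Set ξ.Symplectization := fun n => {p | p.translate (ε * n) ∈ V}
  obtain ⟨n, hn⟩ := hK.elim_directed_cover U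
    (fun n => hVo.preimage (contMDiff_translate _).continuous) (fun p _ => by
      obtain ⟨p', hp'V, hp'⟩ := hVf p.proj
      set a := (coord ξ p').1 - (coord ξ p).1 with ha
      have h1 : p.translate a = p' := by
        apply (coord ξ).injective
        rw [coord_translate]
        refine Prod.ext ?_ hp'.symm
        change (coord ξ p).1 + a = (coord ξ p').1
        rw [ha]
        ring
      obtain ⟨n, hn⟩ := exists_nat_ge (ε * a)
      refine mem_iUnion.2 ⟨n, hmono (ε * a) n p hn ?_⟩
      rwa [← mul_assoc, hε, one_mul, h1])
    (directed_of_isDirected_le fun a b hab p hp => hmono a b p (by exact_mod_cast hab) hp)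
  exact ⟨n, fun S hS p hp => hmono n S p hS (hn hp)⟩

lemma hamiltonianField_const_mul [FiniteDimensional ℝ E] (c : ℝ) {K : ξ.Symplectization → ℝ}
    {p : ξ.Symplectization} (hK : MDifferentiableAt (symplModel E) 𝓘(ℝ, ℝ) K p) :
    hamiltonianField (fun q => c * K q) p = c • hamiltonianField K p := by
  have h : mfderiv (symplModel E) 𝓘(ℝ, ℝ) (fun q => c * K q) p =
      c • mfderiv (symplModel E) 𝓘(ℝ, ℝ) K p := const_smul_mfderiv hK c
  rw [hamiltonianField, h]
  exact map_smul _ c _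

/-- The isotopy produced from a pseudo-isotopy `F`: on `K`, `Ψ_{-S}` is the identity and `Ψ_S`
covers `φ`, once `S` is so large that `τ_{-S}(K)` and `τ_S(K)` lie in the neighborhoods of the ends
on which `F` is the identity and covers `φ`. -/
theorem IsSymplecticallyPseudoIsotopicToId.exists_hamiltonianIsotopy [FiniteDimensional ℝ E]
    [T2Space M] [SecondCountableTopology M] {φ : M → M}
    (hφ : ξ.IsSymplecticallyPseudoIsotopicToId φ) {K : Set ξ.Symplectization} (hK : IsCompact K) :
    ∃ Φ : ℝ → ξ.SymplDiffeo, IsCompactlySupportedHamiltonianIsotopy Φ ∧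
      ∀ p ∈ K, (Φ 1 p).proj = φ p.proj := by
  obtain ⟨F, hF, U, ⟨V, hVU, hVo, hVt, hVf⟩, -, hU⟩ := hφ
  obtain ⟨f, hf, hdf⟩ := hF.exists_primitive
  obtain ⟨U', ⟨V', hVU', hVo', hVt', hVf'⟩, hU'⟩ := hF.eq_id_negative
  obtain ⟨S₁, hS₁⟩ := exists_translate_mem (ε := 1) (by norm_num) hVo
    (fun s hs p hp => by rw [one_mul]; exact hVt s hs p hp) hVf hK
  obtain ⟨S₂, hS₂⟩ := exists_translate_mem (ε := -1) (by norm_num) hVo'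
    (fun s hs p hp => hVt' _ (by linarith) p hp) hVf' hK
  set S := max S₁ S₂ with hS
  -- Time is rescaled so that `[0, 1]` corresponds to `s ∈ [-S, S]`.
  set σ : ℝ → ℝ := fun t => S * (2 * t - 1) with hσ
  have hσs : ContDiff ℝ ∞ σ := by fun_prop
  have hσd : ∀ t, HasDerivAt σ (2 * S) t := fun t => by
    have h : HasDerivAt (fun t : ℝ => S * (2 * t - 1)) (S * (2 * 1)) t :=
      (((hasDerivAt_id' t).const_mul 2).sub_const 1).const_mul S
    exact h.congr_deriv (by ring)
  have hσM : ContMDiff (𝓘(ℝ, ℝ).prod (symplModel E)) (𝓘(ℝ, ℝ).prod (symplModel E)) ∞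
      (fun q : ℝ × ξ.Symplectization => (σ q.1, q.2)) :=
    (hσs.contMDiff.comp contMDiff_fst).prodMk contMDiff_snd
  have hHs : ∀ s, ContMDiff (symplModel E) 𝓘(ℝ, ℝ) ∞ (conjHamiltonian F f s) := fun s =>
    (contMDiff_conjHamiltonian F hf).comp (contMDiff_const.prodMk contMDiff_id)
  obtain ⟨Φ, hΦ, hΦγ⟩ := exists_isotopy_of_compact
    (H := fun t q => (2 * S) * conjHamiltonian F f (σ t) q)
    (contMDiff_const.mul ((contMDiff_conjHamiltonian F hf).comp hσM))
    (((isCompact_Icc (a := (-1 : ℝ)) (b := 2)).prod hK).image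
      ((contMDiff_conjTranslate F).comp hσM).continuous)
  refine ⟨Φ, hΦ, fun p hp => ?_⟩
  have h1 := hΦγ (fun t => conjTranslate F (σ t) p) fun t ht =>
    ⟨⟨(t, p), ⟨Ioo_subset_Icc_self ht, hp⟩, rfl⟩, by
      have h2 := HasMFDerivAt.comp t (hasMFDerivAt_conjTranslate hF.symplectic hf hdf p (σ t))
        (hσd t).hasFDerivAt.hasMFDerivAt
      rw [hamiltonianField_const_mul _ ((hHs _ _).mdifferentiableAt (by simp))]
      refine h2.congr_mfderiv (ContinuousLinearMap.ext_ring ?_)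
      change ((1 : ℝ) • (2 * S)) • hamiltonianField _ _ = (1 : ℝ) • (2 * S) • hamiltonianField _ _
      rw [one_smul, one_smul]⟩
  have h3 : conjTranslate F (σ 0) p = p := by
    have h4 : σ 0 = -1 * S := by simp only [hσ]; ring
    rw [conjTranslate, h4, hU' _ (hVU' (hS₂ S (le_max_right _ _) p hp)),
      Symplectization.translate_translate, add_neg_cancel, Symplectization.translate_zero]
  have h5 : (conjTranslate F (σ 1) p).proj = φ p.proj := by
    have h6 : σ 1 = 1 * S := by simp only [hσ]; ring
    have h7 := hU _ (hVU (hS₁ S (le_max_left _ _) p hp))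
    rw [conjTranslate, h6, proj_translate, ← h7, proj_translate]
  simp only [h3] at h1
  rw [h1, h5]

end ContactStructure

end

theorem lemma2p4 {E M : Type*} [NormedAddCommGroup E] [NormedSpace ℝ E] [FiniteDimensional ℝ E]
    [TopologicalSpace M] [T2Space M] [SecondCountableTopology M] [ChartedSpace E M]
    [IsManifold 𝓘(ℝ, E) ∞ M] (ξ : ContactStructure E M)
    (φ : M ≃ₘ^∞⟮𝓘(ℝ, E), 𝓘(ℝ, E)⟯ M) (hφ : ξ.IsContactomorphism φ)
    (hφ' : ξ.IsSymplecticallyPseudoIsotopicToId φ)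
    (K : Set ξ.Symplectization) (hK : IsCompact K) :
    ∃ Φ : ℝ → ξ.SymplDiffeo, ContactStructure.IsCompactlySupportedHamiltonianIsotopy Φ ∧
      ∀ p ∈ K, (Φ 1 p).proj = φ p.proj := by
  exact hφ'.exists_hamiltonianIsotopy hK
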